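/- Let $A\in\mathbb R^{n\times n}$, $B\in\mathbb R^{n\times m}$, $Q=Q^\top\succeq 0$ in $\mathbb R^{n\times n}$ and $R=R^\top\succ 0$ in $\mathbb R^{m\times m}$. Assume that $(A,B)$ is stabilizable and that every eigenvalue of $A$ on the imaginary axis is $(Q,A)$-observable, i.e. $Av=\lambda v$, $\operatorname{Re}\lambda=0$, $0\ne v\in\mathbb C^n$ imply $Qv\neq 0$. Let $x_0^1,\dots,x_0^n$ span $\mathbb R^n$, put $\Sigma=\sum_{j} x_0^j(x_0^j)^\top$, and let $\gamma>0$ be a real number. Put $A_K=A-BK$ and $\mathcal H=\{K\in\mathbb R^{m\times n}: A_K \text{ is Hurwitz}\}$ (Hurwitz: all eigenvalues have negative real part). For $K\in\mathcal H$ let $$f(K)=\sum_{j=1}^n\int_0^\infty\big(\langle x_j(t),Qx_j(t)\rangle+\langle u_j(t),Ru_j(t)\rangle\big)\,dt,\qquad x_j(t)=e^{A_Kt}x_0^j,\quad u_j(t)=-Kx_j(t),$$ $$X_K=\int_0^\infty e^{A_K^\top t}(K^\top RK+Q)e^{A_Kt}\,dt,\qquad Y_K=\int_0^\infty e^{A_Kt}\,\Sigma\,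 e^{A_K^\top t}\,dt,\qquad N_K=RK-B^\top X_K .$$ Theorem. 1. For every $K\in\mathcal H$, $X_K$ is the unique solution $X$ of $A_K^\top X+XA_K+K^\top RK+Q=0$, and $Y_K$ is the unique solution $Y$ of $A_KY+YA_K^\top+\Sigma=0$. 2. $\mathcal H$ is open, $\langle M,N\rangle_{Y^\gamma}=\operatorname{Tr}(M^\top N\,Y_K^{\gamma})$ for $M,N\in T_K\mathcal H\cong\mathbb R^{m\times n}$ is a smooth Riemannian metric on $\mathcal H$, and $f$ is differentiable on $\mathcal H$, its gradient with respect to this metric being $\operatorname{grad} f(K)=2(RK-B^\top X_K)Y_K^{1-\gamma}$. 3. For every $K_0\in\mathcal H$ the natural gradient flow $$\dot K_t=-2N_{K_t}Y_{K_t}^{1-\gamma},\qquad K_t|_{t=0}=K_0,$$ has exactly one solution $K_t\in\mathcal H$ defined for all $t\ge 0$. 4. $f$ has exactly one minimizer $K_*$ on $\mathcal H$. For every $a\in\mathbb R$ there are constants $r>0$ and $c>0$ such that, for every $K_0\in\mathcal H$ with $f(K_0)\le a$ and all $t\ge 0$, the solution of the flow starting at $K_0$ satisfies $$f(K_t)-f(K_*)\le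 e^{-rt}\big(f(K_0)-f(K_*)\big),\qquad \|K_t-K_*\|_F^2\le c\,e^{-rt}\,\|K_0-K_*\|_F^2 .$$ In particular the energy $f(K_t)-f(K_*)$ converges exponentially to zero, and the trajectory is exponentially stable in the sense of Lyapunov. -/

import Mathlib

open scoped Matrix ContDiff
open scoped Matrix.Norms.Frobenius

noncomputable section

/-- A real square matrix is Hurwitz if all its complex eigenvalues have negative real part. -/
def IsHurwitz {n : ℕ} (M : Matrix (Fin n) (Fin n) ℝ) : Prop :=
  ∀ μ ∈ spectrum ℂ (M.map Complex.ofReal), μ.re < 0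

/-- The real power `Y ^ s` of a symmetric positive definite matrix, by functional calculus:
the eigenvalues are raised to the power `s` and the eigenspaces are kept. -/
def symPow {n : ℕ} (Y : Matrix (Fin n) (Fin n) ℝ) (s : ℝ) : Matrix (Fin n) (Fin n) ℝ :=
  cfc (fun x : ℝ => x ^ s) Y

/-- Data of a continuous-time LQR problem with `n` states and `m` inputs, together with a
list of `n` initial conditions. -/
structure LQR (n m : ℕ) where
  A : Matrix (Fin n) (Fin n) ℝ
  B : Matrix (Fin n) (Fin m) ℝ
  Q : Matrix (Fin n) (Fin n) ℝ
  R : Matrix (Fin m) (Fin m) ℝ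
  x₀ : Fin n → (Fin n → ℝ)

namespace LQR

variable {n m : ℕ}

/-- The closed-loop matrix `A - B K`. -/
def closedLoop (P : LQR n m) (K : Matrix (Fin m) (Fin n) ℝ) : Matrix (Fin n) (Fin n) ℝ :=
  P.A - P.B * K

/-- The set of stabilizing feedback gains. -/
def stabilizing (P : LQR n m) : Set (Matrix (Fin m) (Fin n) ℝ) :=
  {K | IsHurwitz (P.closedLoop K)}

/-- The standard assumptions: `(A, B)` is stabilizable, `Q` is symmetric positive semidefinite,
`R` is symmetric positive definite, every eigenvalue of `A` on the imaginary axis is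
`(Q, A)`-observable, and the initial conditions span the state space. -/
structure Standard (P : LQR n m) : Prop where
  stabilizable : ∃ K : Matrix (Fin m) (Fin n) ℝ, IsHurwitz (P.A - P.B * K)
  posSemidef_Q : P.Q.PosSemidef
  posDef_R : P.R.PosDef
  observable : ∀ (μ : ℂ) (v : Fin n → ℂ), μ.re = 0 → v ≠ 0 →
    (P.A.map Complex.ofReal) *ᵥ v = μ • v → (P.Q.map Complex.ofReal) *ᵥ v ≠ 0
  spanning : Submodule.span ℝ (Set.range P.x₀) = ⊤

/-- The closed-loop state trajectory `x(t) = exp (t (A - B K)) x₀`. -/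
def state (P : LQR n m) (K : Matrix (Fin m) (Fin n) ℝ) (x₀ : Fin n → ℝ) (t : ℝ) : Fin n → ℝ :=
  NormedSpace.exp (t • P.closedLoop K) *ᵥ x₀

/-- The LQR cost `∫₀^∞ (⟨x, Q x⟩ + ⟨u, R u⟩) dt` with `u = -K x`, from the initial state `x₀`.
It is used for stabilizing `K` only, where the integral converges. -/
def costFrom (P : LQR n m) (K : Matrix (Fin m) (Fin n) ℝ) (x₀ : Fin n → ℝ) : ℝ :=
  ∫ t in Set.Ioi (0 : ℝ),
    (P.state K x₀ t ⬝ᵥ (P.Q *ᵥ P.state K x₀ t)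
      + (-(K *ᵥ P.state K x₀ t)) ⬝ᵥ (P.R *ᵥ (-(K *ᵥ P.state K x₀ t))))

/-- The cost `f(K)`: the sum of the LQR costs over the initial conditions. -/
def cost (P : LQR n m) (K : Matrix (Fin m) (Fin n) ℝ) : ℝ :=
  ∑ j, P.costFrom K (P.x₀ j)

/-- `Σ = ∑ⱼ xⱼ xⱼᵀ`. -/
def initCov (P : LQR n m) : Matrix (Fin n) (Fin n) ℝ :=
  ∑ j, Matrix.vecMulVec (P.x₀ j) (P.x₀ j)

/-- `X_K = ∫₀^∞ exp(A_Kᵀ t) (Kᵀ R K + Q) exp(A_K t) dt`. -/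
def valueMatrix (P : LQR n m) (K : Matrix (Fin m) (Fin n) ℝ) : Matrix (Fin n) (Fin n) ℝ :=
  ∫ t in Set.Ioi (0 : ℝ),
    NormedSpace.exp (t • (P.closedLoop K)ᵀ) * (Kᵀ * P.R * K + P.Q)
      * NormedSpace.exp (t • P.closedLoop K)

/-- `Y_K = ∫₀^∞ exp(A_K t) Σ exp(A_Kᵀ t) dt`. -/
def gramian (P : LQR n m) (K : Matrix (Fin m) (Fin n) ℝ) : Matrix (Fin n) (Fin n) ℝ :=
  ∫ t in Set.Ioi (0 : ℝ),
    NormedSpace.exp (t • P.closedLoop K) * P.initCov * NormedSpace.exp (t • (P.closedLoop K)ᵀ)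

/-- `N_K = R K - Bᵀ X_K`. -/
def residual (P : LQR n m) (K : Matrix (Fin m) (Fin n) ℝ) : Matrix (Fin m) (Fin n) ℝ :=
  P.R * K - P.Bᵀ * P.valueMatrix K

/-- `⟨M, N⟩ = Tr(Mᵀ N Y_K ^ γ)` on the tangent space at `K`. -/
def metric (P : LQR n m) (γ : ℝ) (K M N : Matrix (Fin m) (Fin n) ℝ) : ℝ :=
  (Mᵀ * N * symPow (P.gramian K) γ).trace

/-- `K` is defined on `[0, ∞)`, starts at `K₀`, stays in the set of stabilizing gains, and solves
the natural gradient flow `K' = -2 N_K Y_K ^ (1 - γ)`. -/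
structure IsNaturalGradientFlow (P : LQR n m) (γ : ℝ) (K₀ : Matrix (Fin m) (Fin n) ℝ)
    (K : ℝ → Matrix (Fin m) (Fin n) ℝ) : Prop where
  init : K 0 = K₀
  mem : ∀ t, 0 ≤ t → K t ∈ P.stabilizing
  deriv : ∀ t, 0 ≤ t → HasDerivWithinAt K
    (-((2 : ℝ) • (P.residual (K t) * symPow (P.gramian (K t)) (1 - γ)))) (Set.Ici 0) t

/-- `K` minimizes the cost over the set of stabilizing gains. -/
def IsOptimal (P : LQR n m) (K : Matrix (Fin m) (Fin n) ℝ) : Prop :=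
  K ∈ P.stabilizing ∧ ∀ K' ∈ P.stabilizing, P.cost K ≤ P.cost K'

end LQR

/-- `g` is a (smooth) Riemannian metric on the open subset `U` of the vector space `E`, in the
global chart given by the inclusion, with all tangent spaces identified with `E`. -/
structure IsRiemannianMetricOn {E : Type*} [NormedAddCommGroup E] [NormedSpace ℝ E]
    (U : Set E) (g : E → E → E → ℝ) : Prop where
  isOpen : IsOpen U
  add_left : ∀ p ∈ U, ∀ v v' w, g p (v + v') w = g p v w + g p v' w
  smul_left : ∀ p ∈ U, ∀ (a : ℝ) (v w : E), g p (a • v) w = a * g p v w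
  symm : ∀ p ∈ U, ∀ v w, g p v w = g p w v
  pos : ∀ p ∈ U, ∀ v, v ≠ 0 → 0 < g p v v
  smooth : ∀ v w, ContDiffOn ℝ ∞ (fun p => g p v w) U

/-- `G` is the gradient of `f` at `p` with respect to `g`: `df(p)[v] = g_p(G, v)` for all `v`. -/
def IsRiemannianGradientAt {E : Type*} [NormedAddCommGroup E] [NormedSpace ℝ E]
    (g : E → E → E → ℝ) (f : E → ℝ) (p G : E) : Prop :=
  DifferentiableAt ℝ f p ∧ ∀ v, fderiv ℝ f p v = g p G v

end

noncomputable section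

open MeasureTheory Filter Topology Set

variable {n m : ℕ}

/-! Everything is driven by one exact identity, `cost_sub_cost`. Subtracting the Lyapunov equations
of two stabilizing gains `K`, `L` and pairing with `Σ` gives `f(L) - f(K) = Tr(((L-K)ᵀR(L-K) +
(L-K)ᵀN_K + N_Kᵀ(L-K)) Y_L)`. Read infinitesimally it gives `df(K)[V] = 2 Tr(N_Kᵀ V Y_K)`, hence the
gradient. At a minimizer the residual vanishes, so the cost gap is the quadratic form
`Tr((L-K*)ᵀR(L-K*) Y_L)`; this gives uniqueness. Read from `K` towards `K*`, completing the square
gives gradient dominance `f(K) - f(K*) ≤ C‖N_K‖²`.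

Along the flow the cost decreases at rate `4 Tr(NᵀN Y^(2-γ))`. Sublevel sets of `f` are compact
(`isCompact_sublevel`), so there this rate is at least a multiple of `‖N‖²`, and dominance yields
exponential decay. Compactness also makes the cost gap comparable to the squared distance to `K*`,
which transfers the decay to the gain. Finally it yields existence for all time: the field can be
cut off outside a sublevel set that no trajectory leaves.

As `Q` is only semidefinite, the delicate point of compactness is that a limit of stabilizing gains
of bounded cost stays stabilizing. The matrices `X_K` stay bounded, so the Lyapunov equation
survives in the limit, and observability then excludes imaginary eigenvalues.

Smoothness comes from two formulas free of integrals and eigenvectors: Lyapunov integrals are values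
of an inverse operator, and real powers are locally binomial series. -/

open scoped MatrixOrder in
theorem Matrix.PosSemidef.exists_eq_transpose_mul_self {S : Matrix (Fin n) (Fin n) ℝ}
    (hS : S.PosSemidef) : ∃ C : Matrix (Fin n) (Fin n) ℝ, S = Cᵀ * C :=
  CStarAlgebra.nonneg_iff_eq_star_mul_self.1 hS.nonneg

theorem symPow_transpose (Y : Matrix (Fin n) (Fin n) ℝ) (s : ℝ) : (symPow Y s)ᵀ = symPow Y s :=
  (cfc_predicate (fun x : ℝ => x ^ s) Y : IsSelfAdjoint _)

/-- The topology of the Frobenius norm, in the syntactic form that the norm provides. -/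
abbrev Matrix.frobeniusTopology {k l : ℕ} {α : Type*} [NormedAddCommGroup α] :
    TopologicalSpace (Matrix (Fin k) (Fin l) α) :=
  PseudoMetricSpace.toUniformSpace.toTopologicalSpace

attribute [local instance] Matrix.frobeniusTopology

/-! ### Matrix exponential and Hurwitz matrices -/

theorem Matrix.exp_transpose_frobenius (A : Matrix (Fin n) (Fin n) ℝ) :
    NormedSpace.exp Aᵀ = (NormedSpace.exp A)ᵀ :=
  Matrix.exp_transpose A

theorem Matrix.exp_mulVec_of_mulVec_eq_smul (A : Matrix (Fin n) (Fin n) ℂ) (c : ℂ)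
    (v : Fin n → ℂ) (h : A *ᵥ v = c • v) :
    NormedSpace.exp A *ᵥ v = Complex.exp c • v := by
  have hpow : ∀ k : ℕ, (A ^ k) *ᵥ v = c ^ k • v := by
    intro k
    induction k with
    | zero => simp
    | succ k ih =>
      rw [pow_succ, ← Matrix.mulVec_mulVec, h, Matrix.mulVec_smul, ih, smul_smul, pow_succ, mul_comm]
  have h1 := NormedSpace.exp_series_hasSum_exp' (𝕂 := ℂ) A
  let φ : Matrix (Fin n) (Fin n) ℂ →ₗ[ℂ] (Fin n → ℂ) :=
    { toFun := fun M => M *ᵥ v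
      map_add' := fun M N => Matrix.add_mulVec M N v
      map_smul' := fun a M => Matrix.smul_mulVec a M v }
  have h2 : HasSum (fun k : ℕ => φ ((k.factorial : ℂ)⁻¹ • A ^ k)) (φ (NormedSpace.exp A)) :=
    h1.mapL φ.toContinuousLinearMap
  have h3 := (NormedSpace.exp_series_hasSum_exp' (𝕂 := ℂ) c).smul_const v
  rw [← Complex.exp_eq_exp_ℂ] at h3
  refine h2.unique ?_
  convert h3 using 2 with k
  simp only [φ, LinearMap.coe_mk, AddHom.coe_mk, Matrix.smul_mulVec, hpow, smul_eq_mul, smul_smul]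

theorem Matrix.mem_spectrum_iff_exists_mulVec (A : Matrix (Fin n) (Fin n) ℂ) (c : ℂ) :
    c ∈ spectrum ℂ A ↔ ∃ v ≠ 0, A *ᵥ v = c • v := by
  rw [← Matrix.spectrum_toLin', ← Module.End.hasEigenvalue_iff_mem_spectrum]
  constructor
  · intro h
    obtain ⟨v, hv⟩ := h.exists_hasEigenvector
    exact ⟨v, hv.2, by simpa using hv.apply_eq_smul⟩
  · rintro ⟨v, hv, h⟩
    exact Module.End.hasEigenvalue_of_hasEigenvector
      (x := v) ⟨Module.End.mem_eigenspace_iff.2 (by simpa using h), hv⟩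

/-- An eigenspace of `exp A` is invariant under `A`, which commutes with it, so over `ℂ` it contains
an eigenvector of `A`. -/
theorem Matrix.exists_exp_eq_of_mem_spectrum_exp (A : Matrix (Fin n) (Fin n) ℂ) {μ : ℂ}
    (hμ : μ ∈ spectrum ℂ (NormedSpace.exp A)) : ∃ c ∈ spectrum ℂ A, Complex.exp c = μ := by
  obtain ⟨w, hw, hwμ⟩ := (Matrix.mem_spectrum_iff_exists_mulVec _ _).1 hμ
  let E := Module.End.eigenspace (Matrix.toLin' (NormedSpace.exp A)) μ
  have hwE : w ∈ E := Module.End.mem_eigenspace_iff.2 (by simpa using hwμ)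
  have hcomm : NormedSpace.exp A * A = A * NormedSpace.exp A :=
    ((Commute.refl A).exp_right).symm
  have hinv : ∀ x ∈ E, Matrix.toLin' A x ∈ E := by
    intro x hx
    have hx' : NormedSpace.exp A *ᵥ x = μ • x := by
      simpa using Module.End.mem_eigenspace_iff.1 hx
    refine Module.End.mem_eigenspace_iff.2 ?_
    simp only [Matrix.toLin'_apply, Matrix.mulVec_mulVec, hcomm]
    rw [← Matrix.mulVec_mulVec, hx', Matrix.mulVec_smul]
  have : Nontrivial E := ⟨⟨⟨w, hwE⟩, 0, fun h => hw (by simpa using congrArg Subtype.val h)⟩⟩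
  obtain ⟨c, hc⟩ := Module.End.exists_eigenvalue ((Matrix.toLin' A).restrict hinv)
  obtain ⟨v, hv⟩ := hc.exists_hasEigenvector
  have hv0 : (v : Fin n → ℂ) ≠ 0 := fun h => hv.2 (Subtype.ext h)
  have hAv : A *ᵥ (v : Fin n → ℂ) = c • (v : Fin n → ℂ) := by
    simpa using congrArg Subtype.val hv.apply_eq_smul
  refine ⟨c, (Matrix.mem_spectrum_iff_exists_mulVec _ _).2 ⟨v, hv0, hAv⟩, ?_⟩
  have h1 := Matrix.exp_mulVec_of_mulVec_eq_smul A c v hAv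
  have h2 : NormedSpace.exp A *ᵥ (v : Fin n → ℂ) = μ • (v : Fin n → ℂ) := by
    simpa using Module.End.mem_eigenspace_iff.1 v.2
  exact smul_left_injective ℂ hv0 (h1.symm.trans h2)

theorem Matrix.exp_map_ofReal (A : Matrix (Fin n) (Fin n) ℝ) :
    NormedSpace.exp (A.map Complex.ofReal) = (NormedSpace.exp A).map Complex.ofReal := by
  have := NormedSpace.map_exp (Complex.ofRealHom.mapMatrix (m := Fin n))
    (Continuous.matrix_map continuous_id Complex.continuous_ofReal) A
  exact this.symm

theorem Matrix.norm_map_ofReal (A : Matrix (Fin n) (Fin n) ℝ) :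
    ‖A.map Complex.ofReal‖ = ‖A‖ :=
  Matrix.frobenius_norm_map_eq A _ fun a => Complex.norm_real a

/-- Gelfand's formula: the powers decay geometrically and absorb any fixed factor. The factor is
needed because the Frobenius norm of the identity is not 1 in general. -/
theorem Matrix.exists_norm_pow_mul_lt_one (a : Matrix (Fin n) (Fin n) ℂ)
    (h : ∀ μ ∈ spectrum ℂ a, ‖μ‖ < 1) (c : ℝ) : ∃ k : ℕ, 0 < k ∧ ‖a ^ k‖ * c < 1 := by
  rcases n.eq_zero_or_pos with rfl | hn
  · refine ⟨1, one_pos, ?_⟩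
    rw [Subsingleton.elim (a ^ 1) 0]; simp
  have : Nonempty (Fin n) := ⟨⟨0, hn⟩⟩
  have hρ : spectralRadius ℂ a < 1 := by
    refine spectrum.spectralRadius_lt_of_forall_lt (r := 1) a fun z hz => ?_
    exact_mod_cast h z hz
  obtain ⟨q, hq, hq1⟩ := ENNReal.lt_iff_exists_nnreal_btwn.1 hρ
  have h1 := (spectrum.pow_nnnorm_pow_one_div_tendsto_nhds_spectralRadius a).eventually_lt_const hq
  have hq1' : (q : ℝ) < 1 := by exact_mod_cast hq1
  have h2 : Tendsto (fun k : ℕ => (q : ℝ) ^ k * |c|) atTop (𝓝 (0 * |c|)) :=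
    (tendsto_pow_atTop_nhds_zero_of_lt_one q.2 hq1').mul_const _
  rw [zero_mul] at h2
  obtain ⟨k, hk, hk1, hk0⟩ :=
    (h1.and ((h2.eventually_lt_const zero_lt_one).and (eventually_gt_atTop 0))).exists
  refine ⟨k, hk0, lt_of_le_of_lt ?_ hk1⟩
  have h3 : (‖a ^ k‖₊ : ENNReal) ≤ (q : ENNReal) ^ k := by
    have := ENNReal.rpow_le_rpow hk.le (Nat.cast_nonneg k : (0 : ℝ) ≤ k)
    rwa [← ENNReal.rpow_mul, one_div, inv_mul_cancel₀ (by positivity), ENNReal.rpow_one,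
      ENNReal.rpow_natCast] at this
  have h4 : ‖a ^ k‖ ≤ (q : ℝ) ^ k := by exact_mod_cast h3
  exact (mul_le_mul_of_nonneg_left (le_abs_self c) (norm_nonneg _)).trans
    (mul_le_mul_of_nonneg_right h4 (abs_nonneg c))

/-- Trades the spectrum for one strict norm inequality, visibly open in `A` and invariant under
transposition. Forwards, the eigenvalues of `exp A` lie in the open unit disc, so a high power is
small; backwards, the norm times `‖1‖` bounds every eigenvalue `exp (T μ)`. -/
theorem isHurwitz_iff_exists_norm_exp_lt (A : Matrix (Fin n) (Fin n) ℝ) :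
    IsHurwitz A ↔ ∃ T : ℝ, 0 < T ∧
      ‖NormedSpace.exp (T • A)‖ * ‖(1 : Matrix (Fin n) (Fin n) ℝ)‖ < 1 := by
  constructor
  · intro hA
    obtain ⟨k, hk, hlt⟩ := Matrix.exists_norm_pow_mul_lt_one
      (NormedSpace.exp (A.map Complex.ofReal)) (fun μ hμ => by
        obtain ⟨c, hc, rfl⟩ := Matrix.exists_exp_eq_of_mem_spectrum_exp _ hμ
        rw [Complex.norm_exp]
        exact Real.exp_lt_one_iff.2 (hA c hc)) ‖(1 : Matrix (Fin n) (Fin n) ℝ)‖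
    refine ⟨k, by exact_mod_cast hk, ?_⟩
    have : NormedSpace.exp ((k : ℝ) • A) = NormedSpace.exp A ^ k := by
      rw [← NormedSpace.exp_nsmul, Nat.cast_smul_eq_nsmul]
    rw [this]
    have h2 : NormedSpace.exp (A.map Complex.ofReal) ^ k
        = (NormedSpace.exp A ^ k).map Complex.ofReal := by
      rw [Matrix.exp_map_ofReal]
      exact (map_pow (Complex.ofRealHom.mapMatrix (m := Fin n)) (NormedSpace.exp A) k).symm
    rwa [h2, Matrix.norm_map_ofReal] at hlt
  · rintro ⟨T, hT, hlt⟩ μ hμ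
    have h1 : (T : ℂ) * μ ∈ spectrum ℂ ((T • A).map Complex.ofReal) := by
      obtain ⟨v, hv, h⟩ := (Matrix.mem_spectrum_iff_exists_mulVec _ _).1 hμ
      refine (Matrix.mem_spectrum_iff_exists_mulVec _ _).2 ⟨v, hv, ?_⟩
      have : (T • A).map Complex.ofReal = (T : ℂ) • A.map Complex.ofReal := by
        ext; simp
      rw [this, Matrix.smul_mulVec, h, smul_smul]
    have h2 : ‖NormedSpace.exp ((T : ℂ) * μ)‖ ≤ ‖NormedSpace.exp ((T • A).map Complex.ofReal)‖
        * ‖(1 : Matrix (Fin n) (Fin n) ℂ)‖ :=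
      spectrum.norm_le_norm_mul_of_mem (spectrum.exp_mem_exp _ h1)
    rw [Matrix.exp_map_ofReal, Matrix.norm_map_ofReal] at h2
    have h3 : ‖(1 : Matrix (Fin n) (Fin n) ℂ)‖ = ‖(1 : Matrix (Fin n) (Fin n) ℝ)‖ := by
      rw [← Matrix.norm_map_ofReal 1]; simp
    rw [h3, ← Complex.exp_eq_exp_ℂ, Complex.norm_exp] at h2
    have h4 := Real.exp_lt_one_iff.1 (h2.trans_lt hlt)
    simp only [Complex.mul_re, Complex.ofReal_re, Complex.ofReal_im, zero_mul, sub_zero] at h4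
    by_contra! h5
    exact absurd h4 (not_lt.2 (mul_nonneg hT.le h5))

theorem IsHurwitz.transpose {A : Matrix (Fin n) (Fin n) ℝ} (hA : IsHurwitz A) : IsHurwitz Aᵀ := by
  rw [isHurwitz_iff_exists_norm_exp_lt] at hA ⊢
  obtain ⟨T, hT, h⟩ := hA
  refine ⟨T, hT, ?_⟩
  rwa [← Matrix.transpose_smul, Matrix.exp_transpose_frobenius, Matrix.frobenius_norm_transpose]

theorem isOpen_setOf_isHurwitz : IsOpen {A : Matrix (Fin n) (Fin n) ℝ | IsHurwitz A} := by
  have : {A : Matrix (Fin n) (Fin n) ℝ | IsHurwitz A} = ⋃ T : Set.Ioi (0 : ℝ),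
      {A | ‖NormedSpace.exp ((T : ℝ) • A)‖ * ‖(1 : Matrix (Fin n) (Fin n) ℝ)‖ < 1} := by
    ext A
    simp [isHurwitz_iff_exists_norm_exp_lt]
  rw [this]
  refine isOpen_iUnion fun T => isOpen_lt ?_ continuous_const
  have : Continuous fun A : Matrix (Fin n) (Fin n) ℝ => NormedSpace.exp ((T : ℝ) • A) :=
    (NormedSpace.exp_continuous).comp (continuous_const_smul (T : ℝ))
  exact this.norm.mul continuous_const

theorem continuous_exp_smul (A : Matrix (Fin n) (Fin n) ℝ) :
    Continuous fun t : ℝ => NormedSpace.exp (t • A) :=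
  (NormedSpace.exp_continuous).comp (continuous_id.smul continuous_const)

theorem IsHurwitz.exists_norm_exp_le {A : Matrix (Fin n) (Fin n) ℝ} (hA : IsHurwitz A) :
    ∃ C w : ℝ, 0 < w ∧ ∀ t : ℝ, 0 ≤ t → ‖NormedSpace.exp (t • A)‖ ≤ C * Real.exp (-(w * t)) := by
  obtain ⟨T, hT, hlt⟩ := (isHurwitz_iff_exists_norm_exp_lt A).1 hA
  have hq : ‖NormedSpace.exp (T • A)‖ < 1 := by
    rcases n.eq_zero_or_pos with rfl | hn
    · rw [Subsingleton.elim (NormedSpace.exp (T • A)) 0]; simp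
    · have : Nonempty (Fin n) := ⟨⟨0, hn⟩⟩
      have h1 : 1 ≤ ‖(1 : Matrix (Fin n) (Fin n) ℝ)‖ := by
        have := norm_mul_le (1 : Matrix (Fin n) (Fin n) ℝ) 1
        rw [one_mul] at this
        have h0 : 0 < ‖(1 : Matrix (Fin n) (Fin n) ℝ)‖ := norm_pos_iff.2 one_ne_zero
        exact le_of_mul_le_mul_right (by simpa using this) h0
      exact lt_of_le_of_lt (le_mul_of_one_le_right (norm_nonneg _) h1) hlt
  -- The maximum keeps `q` positive when `n = 0`, so that `log q` is usable; `w` is then fixed by `q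
  -- * exp (w * T) = 1`, which makes `g` below nonincreasing under the shift by `T`.
  set q : ℝ := max ‖NormedSpace.exp (T • A)‖ (1 / 2) with hqdef
  have hq0 : 0 < q := lt_of_lt_of_le (by norm_num) (le_max_right _ _)
  have hq1 : q < 1 := max_lt hq (by norm_num)
  set w : ℝ := -Real.log q / T with hw
  have hw0 : 0 < w := div_pos (neg_pos.2 (Real.log_neg hq0 hq1)) hT
  have hqw : q * Real.exp (w * T) = 1 := by
    rw [hw, div_mul_cancel₀ _ hT.ne', Real.exp_neg, Real.exp_log hq0, mul_inv_cancel₀ hq0.ne']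
  let g : ℝ → ℝ := fun t => ‖NormedSpace.exp (t • A)‖ * Real.exp (w * t)
  have hg : Continuous g := (continuous_exp_smul A).norm.mul (by fun_prop)
  have hstep : ∀ t, g (t + T) ≤ g t := by
    intro t
    have h1 : NormedSpace.exp ((t + T) • A)
        = NormedSpace.exp (t • A) * NormedSpace.exp (T • A) := by
      rw [add_smul, NormedSpace.exp_add_of_commute]
      exact ((Commute.refl A).smul_left t).smul_right T
    have h2 : ‖NormedSpace.exp ((t + T) • A)‖ ≤ ‖NormedSpace.exp (t • A)‖ * q := by
      rw [h1]
      exact (norm_mul_le _ _).trans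
        (mul_le_mul_of_nonneg_left (le_max_left _ _) (norm_nonneg _))
    calc g (t + T) ≤ ‖NormedSpace.exp (t • A)‖ * q * Real.exp (w * (t + T)) :=
          mul_le_mul_of_nonneg_right h2 (Real.exp_pos _).le
      _ = ‖NormedSpace.exp (t • A)‖ * Real.exp (w * t) * (q * Real.exp (w * T)) := by
          rw [mul_add, Real.exp_add]; ring
      _ = g t := by rw [hqw, mul_one]
  obtain ⟨C, hC⟩ := (isCompact_Icc (a := (0 : ℝ)) (b := T)).bddAbove_image hg.continuousOn
  have hb : ∀ k : ℕ, ∀ t, 0 ≤ t → t ≤ (k + 1) * T → g t ≤ C := by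
    intro k
    induction k with
    | zero => exact fun t h0 h1 => hC ⟨t, ⟨h0, by simpa using h1⟩, rfl⟩
    | succ k ih =>
      intro t h0 h1
      rcases le_total t T with h | h
      · exact hC ⟨t, ⟨h0, h⟩, rfl⟩
      · have := hstep (t - T)
        rw [sub_add_cancel] at this
        refine this.trans (ih _ (sub_nonneg.2 h) ?_)
        push_cast at h1
        linarith
  refine ⟨C, w, hw0, fun t ht => ?_⟩
  obtain ⟨k, hk⟩ := exists_nat_ge (t / T)
  have h1 : g t ≤ C := hb k t ht (by
    rw [div_le_iff₀ hT] at hk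
    linarith)
  rw [Real.exp_neg, ← div_eq_mul_inv, le_div_iff₀ (Real.exp_pos _)]
  exact h1

/-! ### Lyapunov equations -/

/-- The Lyapunov operator `Z ↦ A Z + Z Aᵀ`. -/
def lyapunovOp (A : Matrix (Fin n) (Fin n) ℝ) :
    Matrix (Fin n) (Fin n) ℝ →L[ℝ] Matrix (Fin n) (Fin n) ℝ :=
  ContinuousLinearMap.mul ℝ _ A + (ContinuousLinearMap.mul ℝ _).flip Aᵀ

@[simp]
theorem lyapunovOp_apply (A Z : Matrix (Fin n) (Fin n) ℝ) : lyapunovOp A Z = A * Z + Z * Aᵀ := rfl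

/-- The integral `∫₀^∞ exp(t A) S exp(t Aᵀ) dt`. -/
def lyapunovIntegral (A S : Matrix (Fin n) (Fin n) ℝ) : Matrix (Fin n) (Fin n) ℝ :=
  ∫ t in Set.Ioi (0 : ℝ), NormedSpace.exp (t • A) * S * NormedSpace.exp (t • Aᵀ)

theorem hasDerivAt_exp_mul_mul_exp (A Z : Matrix (Fin n) (Fin n) ℝ) (t : ℝ) :
    HasDerivAt (fun t : ℝ => NormedSpace.exp (t • A) * Z * NormedSpace.exp (t • Aᵀ))
      (NormedSpace.exp (t • A) * lyapunovOp A Z * NormedSpace.exp (t • Aᵀ)) t := by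
  have h1 : HasDerivAt (fun t : ℝ => NormedSpace.exp (t • A)) (NormedSpace.exp (t • A) * A) t :=
    hasDerivAt_exp_smul_const A t
  have h2 : HasDerivAt (fun t : ℝ => NormedSpace.exp (t • Aᵀ))
      (Aᵀ * NormedSpace.exp (t • Aᵀ)) t :=
    hasDerivAt_exp_smul_const' Aᵀ t
  refine ((h1.mul_const Z).mul h2).congr_deriv ?_
  simp only [lyapunovOp_apply]
  noncomm_ring

theorem IsHurwitz.exists_norm_exp_mul_mul_exp_le {A : Matrix (Fin n) (Fin n) ℝ}
    (hA : IsHurwitz A) (S : Matrix (Fin n) (Fin n) ℝ) :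
    ∃ C w : ℝ, 0 < w ∧ ∀ t : ℝ, 0 ≤ t →
      ‖NormedSpace.exp (t • A) * S * NormedSpace.exp (t • Aᵀ)‖ ≤ C * Real.exp (-w * t) := by
  obtain ⟨C, w, hw, h⟩ := hA.exists_norm_exp_le
  refine ⟨C * ‖S‖ * C, 2 * w, by positivity, fun t ht => ?_⟩
  have h1 := h t ht
  have h2 : ‖NormedSpace.exp (t • Aᵀ)‖ = ‖NormedSpace.exp (t • A)‖ := by
    rw [← Matrix.transpose_smul, Matrix.exp_transpose_frobenius, Matrix.frobenius_norm_transpose]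
  have h0 : 0 ≤ C * Real.exp (-(w * t)) := (norm_nonneg _).trans h1
  calc ‖NormedSpace.exp (t • A) * S * NormedSpace.exp (t • Aᵀ)‖
      ≤ ‖NormedSpace.exp (t • A)‖ * ‖S‖ * ‖NormedSpace.exp (t • Aᵀ)‖ :=
        (norm_mul_le _ _).trans (mul_le_mul_of_nonneg_right (norm_mul_le _ _) (norm_nonneg _))
    _ ≤ (C * Real.exp (-(w * t))) * ‖S‖ * (C * Real.exp (-(w * t))) := by
        rw [h2]; gcongr
    _ = C * ‖S‖ * C * Real.exp (-(2 * w) * t) := by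
        rw [show -(2 * w) * t = -(w * t) + -(w * t) by ring, Real.exp_add]; ring

theorem continuous_exp_mul_mul_exp (A S : Matrix (Fin n) (Fin n) ℝ) :
    Continuous fun t : ℝ => NormedSpace.exp (t • A) * S * NormedSpace.exp (t • Aᵀ) :=
  continuous_iff_continuousAt.2 fun t => (hasDerivAt_exp_mul_mul_exp A S t).continuousAt

theorem IsHurwitz.integrableOn {A : Matrix (Fin n) (Fin n) ℝ} (hA : IsHurwitz A)
    (S : Matrix (Fin n) (Fin n) ℝ) :
    IntegrableOn (fun t : ℝ => NormedSpace.exp (t • A) * S * NormedSpace.exp (t • Aᵀ))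
      (Set.Ioi 0) := by
  obtain ⟨C, w, hw, h⟩ := hA.exists_norm_exp_mul_mul_exp_le S
  refine Integrable.mono' ((exp_neg_integrableOn_Ioi 0 hw).const_mul C)
    (continuous_exp_mul_mul_exp A S).aestronglyMeasurable ?_
  filter_upwards [ae_restrict_mem measurableSet_Ioi] with t ht
  exact h t (le_of_lt ht)

theorem IsHurwitz.tendsto_exp_mul_mul_exp {A : Matrix (Fin n) (Fin n) ℝ} (hA : IsHurwitz A)
    (S : Matrix (Fin n) (Fin n) ℝ) :
    Tendsto (fun t : ℝ => NormedSpace.exp (t • A) * S * NormedSpace.exp (t • Aᵀ)) atTop (𝓝 0) := by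
  obtain ⟨C, w, hw, h⟩ := hA.exists_norm_exp_mul_mul_exp_le S
  have h1 : Tendsto (fun t : ℝ => C * Real.exp (-w * t)) atTop (𝓝 (C * 0)) :=
    (Real.tendsto_exp_atBot.comp
      (tendsto_id.const_mul_atTop_of_neg (neg_lt_zero.2 hw))).const_mul C
  rw [mul_zero] at h1
  exact squeeze_zero_norm' ((eventually_ge_atTop 0).mono fun t ht => h t ht) h1

/-- The curve `exp (t A) Y exp (t Aᵀ)` runs from `Y` to `0`, and by the equation its derivative is
minus the integrand. -/
theorem IsHurwitz.eq_lyapunovIntegral {A S Y : Matrix (Fin n) (Fin n) ℝ} (hA : IsHurwitz A)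
    (h : A * Y + Y * Aᵀ + S = 0) : Y = lyapunovIntegral A S := by
  have h1 : lyapunovOp A Y = -S := eq_neg_of_add_eq_zero_left h
  have h2 := integral_Ioi_of_hasDerivAt_of_tendsto (a := 0)
    (continuous_exp_mul_mul_exp A Y).continuousWithinAt
    (fun t _ => hasDerivAt_exp_mul_mul_exp A Y t) (hA.integrableOn _)
    (hA.tendsto_exp_mul_mul_exp Y)
  simp only [h1, mul_neg, neg_mul, integral_neg, zero_smul, NormedSpace.exp_zero, one_mul,
    mul_one, zero_sub, neg_inj] at h2
  exact h2.symm

theorem IsHurwitz.lyapunovOp_bijective {A : Matrix (Fin n) (Fin n) ℝ} (hA : IsHurwitz A) :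
    Function.Bijective (lyapunovOp A) := by
  have hinj : Function.Injective (lyapunovOp A).toLinearMap := by
    rw [injective_iff_map_eq_zero]
    intro Z hZ
    rw [hA.eq_lyapunovIntegral (S := 0) (Y := Z) (by simpa using hZ)]
    simp [lyapunovIntegral]
  exact ⟨hinj, LinearMap.injective_iff_surjective.1 hinj⟩

/-- Uniqueness makes the operator injective, hence surjective in finite dimension; the solution so
obtained must be the integral. -/
theorem IsHurwitz.lyapunov_iff {A : Matrix (Fin n) (Fin n) ℝ} (hA : IsHurwitz A)
    (S Y : Matrix (Fin n) (Fin n) ℝ) :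
    A * Y + Y * Aᵀ + S = 0 ↔ Y = lyapunovIntegral A S := by
  refine ⟨hA.eq_lyapunovIntegral, ?_⟩
  rintro rfl
  obtain ⟨Z, hZ⟩ := hA.lyapunovOp_bijective.2 (-S)
  have hZ' : A * Z + Z * Aᵀ + S = 0 := by
    rw [lyapunovOp_apply] at hZ; rw [hZ]; simp
  rwa [← hA.eq_lyapunovIntegral hZ']

theorem contDiff_lyapunovOp {k : ℕ∞ω} :
    ContDiff ℝ k fun A : Matrix (Fin n) (Fin n) ℝ => lyapunovOp A := by
  let L : Matrix (Fin n) (Fin n) ℝ →ₗ[ℝ]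
      (Matrix (Fin n) (Fin n) ℝ →L[ℝ] Matrix (Fin n) (Fin n) ℝ) :=
    { toFun := lyapunovOp
      map_add' := fun A B => by
        ext1 Z
        simp only [lyapunovOp_apply, add_mul, mul_add, Matrix.transpose_add,
          add_apply]
        abel
      map_smul' := fun c A => by
        ext1 Z
        simp [lyapunovOp_apply, smul_add] }
  exact L.toContinuousLinearMap.contDiff

/-- The Lyapunov operator of a Hurwitz matrix as a continuous linear equivalence. -/
def IsHurwitz.lyapunovEquiv {A : Matrix (Fin n) (Fin n) ℝ} (hA : IsHurwitz A) :
    Matrix (Fin n) (Fin n) ℝ ≃L[ℝ] Matrix (Fin n) (Fin n) ℝ :=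
  (LinearEquiv.ofBijective (lyapunovOp A).toLinearMap
    hA.lyapunovOp_bijective).toContinuousLinearEquiv

theorem IsHurwitz.coe_lyapunovEquiv {A : Matrix (Fin n) (Fin n) ℝ} (hA : IsHurwitz A) :
    (hA.lyapunovEquiv : Matrix (Fin n) (Fin n) ℝ →L[ℝ] Matrix (Fin n) (Fin n) ℝ) = lyapunovOp A :=
  rfl

/-- Operator inversion is smooth at invertible operators, so this form gives smooth dependence on
`A` and `S` without differentiating under the integral. -/
theorem IsHurwitz.lyapunovIntegral_eq_inverse {A : Matrix (Fin n) (Fin n) ℝ} (hA : IsHurwitz A)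
    (S : Matrix (Fin n) (Fin n) ℝ) :
    lyapunovIntegral A S = -(ContinuousLinearMap.inverse (lyapunovOp A) S) := by
  have h1 := (hA.lyapunov_iff S _).2 rfl
  have h2 : hA.lyapunovEquiv (lyapunovIntegral A S) = -S := eq_neg_of_add_eq_zero_left h1
  rw [← hA.coe_lyapunovEquiv, ContinuousLinearMap.inverse_equiv]
  have h3 : lyapunovIntegral A S = hA.lyapunovEquiv.symm (-S) := by
    rw [← h2, ContinuousLinearEquiv.symm_apply_apply]
  rw [h3, map_neg]
  rfl

theorem IsHurwitz.contDiffAt_inverse_lyapunovOp {k : ℕ∞ω} {A : Matrix (Fin n) (Fin n) ℝ}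
    (hA : IsHurwitz A) :
    ContDiffAt ℝ k (fun A : Matrix (Fin n) (Fin n) ℝ =>
      ContinuousLinearMap.inverse (lyapunovOp A)) A := by
  have h : ContDiffAt ℝ k ContinuousLinearMap.inverse
      (hA.lyapunovEquiv : Matrix (Fin n) (Fin n) ℝ →L[ℝ] Matrix (Fin n) (Fin n) ℝ) :=
    contDiffAt_map_inverse hA.lyapunovEquiv
  rw [hA.coe_lyapunovEquiv] at h
  exact h.comp A contDiff_lyapunovOp.contDiffAt

theorem ContDiffAt.lyapunovIntegral {E : Type*} [NormedAddCommGroup E] [NormedSpace ℝ E]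
    {k : ℕ∞ω} {A S : E → Matrix (Fin n) (Fin n) ℝ} {x : E} (hx : IsHurwitz (A x))
    (hA : ContDiffAt ℝ k A x) (hS : ContDiffAt ℝ k S x) :
    ContDiffAt ℝ k (fun y => lyapunovIntegral (A y) (S y)) x := by
  have h1 : ContDiffAt ℝ k (fun y => ContinuousLinearMap.inverse (lyapunovOp (A y))) x :=
    hx.contDiffAt_inverse_lyapunovOp.comp x hA
  refine (h1.clm_apply hS).neg.congr_of_eventuallyEq ?_
  filter_upwards [hA.continuousAt.eventually (isOpen_setOf_isHurwitz.mem_nhds hx)] with y hy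
  exact IsHurwitz.lyapunovIntegral_eq_inverse hy _

theorem IsHurwitz.dotProduct_lyapunovIntegral_mulVec {A : Matrix (Fin n) (Fin n) ℝ}
    (hA : IsHurwitz A) (S : Matrix (Fin n) (Fin n) ℝ) (x : Fin n → ℝ) :
    x ⬝ᵥ (lyapunovIntegral A S *ᵥ x) =
      ∫ t in Set.Ioi (0 : ℝ), (NormedSpace.exp (t • Aᵀ) *ᵥ x) ⬝ᵥ
        (S *ᵥ (NormedSpace.exp (t • Aᵀ) *ᵥ x)) := by
  let φ : Matrix (Fin n) (Fin n) ℝ →ₗ[ℝ] ℝ :=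
    { toFun := fun M => x ⬝ᵥ (M *ᵥ x)
      map_add' := fun M N => by rw [Matrix.add_mulVec, dotProduct_add]
      map_smul' := fun a M => by rw [Matrix.smul_mulVec, dotProduct_smul, RingHom.id_apply] }
  have h1 := φ.toContinuousLinearMap.integral_comp_comm (hA.integrableOn S)
  refine Eq.trans h1.symm (integral_congr_ae (Eventually.of_forall fun t => ?_))
  change x ⬝ᵥ (NormedSpace.exp (t • A) * S * NormedSpace.exp (t • Aᵀ)) *ᵥ x =
    (NormedSpace.exp (t • Aᵀ) *ᵥ x) ⬝ᵥ (S *ᵥ (NormedSpace.exp (t • Aᵀ) *ᵥ x))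
  rw [← Matrix.transpose_smul, Matrix.exp_transpose_frobenius, ← Matrix.mulVec_mulVec,
    ← Matrix.mulVec_mulVec, Matrix.dotProduct_mulVec, ← Matrix.mulVec_transpose]

theorem IsHurwitz.lyapunovIntegral_posSemidef {A S : Matrix (Fin n) (Fin n) ℝ}
    (hA : IsHurwitz A) (hS : S.PosSemidef) : (lyapunovIntegral A S).PosSemidef := by
  refine Matrix.PosSemidef.of_dotProduct_mulVec_nonneg ?_ fun x => ?_
  -- Symmetry: the transpose solves the same equation.
  · have h := congrArg Matrix.transpose ((hA.lyapunov_iff S _).2 rfl)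
    have hS' : Sᵀ = S := hS.isHermitian
    simp only [Matrix.transpose_add, Matrix.transpose_mul, Matrix.transpose_transpose,
      Matrix.transpose_zero, hS'] at h
    rw [add_comm (_ * Aᵀ)] at h
    exact hA.eq_lyapunovIntegral h
  · rw [star_trivial, hA.dotProduct_lyapunovIntegral_mulVec]
    refine integral_nonneg fun t => ?_
    simpa using hS.dotProduct_mulVec_nonneg (NormedSpace.exp (t • Aᵀ) *ᵥ x)

/-- `ε • 1` solves the Lyapunov equation with source `-ε • (A + Aᵀ)`, so the difference solves the
one with the assumed semidefinite source. -/
theorem IsHurwitz.lyapunovIntegral_sub_smul_one_posSemidef {A S : Matrix (Fin n) (Fin n) ℝ}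
    (hA : IsHurwitz A) {ε : ℝ} (hS : (S + ε • (A + Aᵀ)).PosSemidef) :
    (lyapunovIntegral A S - ε • 1).PosSemidef := by
  have h := (hA.lyapunov_iff S _).2 rfl
  have h2 : lyapunovIntegral A S - ε • 1 = lyapunovIntegral A (S + ε • (A + Aᵀ)) := by
    refine hA.eq_lyapunovIntegral ?_
    rw [← h]
    simp only [mul_sub, sub_mul, Algebra.mul_smul_comm, Algebra.smul_mul_assoc, one_mul, mul_one,
      smul_add]
    abel
  rw [h2]
  exact hA.lyapunovIntegral_posSemidef hS

/-- The Lyapunov operators of `A` and `Aᵀ` are adjoint for the trace pairing, and so are their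
inverses. This exchanges value matrix and Gramian. -/
theorem IsHurwitz.trace_lyapunovIntegral_mul {A : Matrix (Fin n) (Fin n) ℝ} (hA : IsHurwitz A)
    (S T : Matrix (Fin n) (Fin n) ℝ) :
    (lyapunovIntegral Aᵀ S * T).trace = (S * lyapunovIntegral A T).trace := by
  have h1 := (hA.transpose.lyapunov_iff S _).2 rfl
  have h2 := (hA.lyapunov_iff T _).2 rfl
  rw [Matrix.transpose_transpose] at h1
  set X := lyapunovIntegral Aᵀ S
  set Y := lyapunovIntegral A T
  have hT : T = -(A * Y + Y * Aᵀ) := (neg_eq_of_add_eq_zero_right h2).symm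
  have hS : S = -(Aᵀ * X + X * A) := (neg_eq_of_add_eq_zero_right h1).symm
  rw [hT, hS]
  simp only [mul_neg, neg_mul, Matrix.trace_neg, mul_add, add_mul, Matrix.trace_add, ← mul_assoc]
  rw [Matrix.trace_mul_cycle X Y Aᵀ, add_comm]

/-! ### Trace, norm and quadratic form inequalities -/

theorem Matrix.PosSemidef.trace_mul_nonneg {S T : Matrix (Fin n) (Fin n) ℝ} (hS : S.PosSemidef)
    (hT : T.PosSemidef) : 0 ≤ (S * T).trace := by
  obtain ⟨C, rfl⟩ := hS.exists_eq_transpose_mul_self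
  rw [Matrix.trace_mul_cycle, Matrix.trace_mul_comm, ← mul_assoc]
  exact (hT.mul_mul_conjTranspose_same C).trace_nonneg

theorem Matrix.frobenius_norm_sq (M : Matrix (Fin m) (Fin n) ℝ) : ‖M‖ ^ 2 = (Mᵀ * M).trace := by
  have h0 : (0 : ℝ) ≤ ∑ i, ∑ j, M i j ^ 2 := by positivity
  rw [Matrix.frobenius_norm_def]
  simp only [Real.norm_eq_abs, Real.rpow_two, sq_abs]
  rw [← Real.rpow_natCast, ← Real.rpow_mul h0]
  norm_num
  simp only [Matrix.trace, Matrix.diag, Matrix.mul_apply, Matrix.transpose_apply]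
  rw [Finset.sum_comm]
  simp only [sq]

theorem Matrix.PosSemidef.norm_le_trace {S : Matrix (Fin n) (Fin n) ℝ} (hS : S.PosSemidef) :
    ‖S‖ ≤ S.trace := by
  obtain ⟨C, rfl⟩ := hS.exists_eq_transpose_mul_self
  rw [← Matrix.frobenius_norm_sq]
  refine le_trans (norm_mul_le _ _) (le_of_eq ?_)
  rw [Matrix.frobenius_norm_transpose, ← sq]

/-- By homogeneity it suffices to bound `q` on the compact set `S × sphere`, where it is continuous
and positive. -/
theorem exists_forall_mul_norm_sq_le {E F : Type*} [NormedAddCommGroup E] [NormedSpace ℝ E]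
    [FiniteDimensional ℝ E] [TopologicalSpace F] {S : Set F} (hS : IsCompact S) {q : F → E → ℝ}
    (hq : ContinuousOn (Function.uncurry q) (S ×ˢ univ))
    (hom : ∀ p ∈ S, ∀ (a : ℝ) v, q p (a • v) = a ^ 2 * q p v)
    (pos : ∀ p ∈ S, ∀ v, v ≠ 0 → 0 < q p v) :
    ∃ c > 0, ∀ p ∈ S, ∀ v, c * ‖v‖ ^ 2 ≤ q p v := by
  have : ProperSpace E := FiniteDimensional.proper_real E
  have hC : IsCompact (S ×ˢ Metric.sphere (0 : E) 1) := hS.prod (isCompact_sphere 0 1)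
  have hpos : ∀ x ∈ S ×ˢ Metric.sphere (0 : E) 1, 0 < Function.uncurry q x := by
    rintro ⟨p, v⟩ ⟨hp, hv⟩
    refine pos p hp v ?_
    rintro rfl
    simp at hv
  obtain ⟨c, hc, h⟩ := hC.exists_forall_le' (hq.mono (prod_mono_right (subset_univ _))) hpos
  refine ⟨c, hc, fun p hp v => ?_⟩
  rcases eq_or_ne v 0 with rfl | hv
  · have := hom p hp 0 0
    simp only [zero_smul] at this
    rw [this]; simp
  · have hv' : ‖v‖ ≠ 0 := norm_ne_zero_iff.2 hv
    have h1 := h (p, ‖v‖⁻¹ • v) ⟨hp, by simp [norm_smul, hv']⟩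
    simp only [Function.uncurry_apply_pair, hom p hp] at h1
    rw [inv_pow, inv_mul_eq_div, le_div_iff₀ (by positivity)] at h1
    exact h1

theorem exists_forall_le_mul_norm_sq {E F : Type*} [NormedAddCommGroup E] [NormedSpace ℝ E]
    [FiniteDimensional ℝ E] [TopologicalSpace F] {S : Set F} (hS : IsCompact S) {q : F → E → ℝ}
    (hq : ContinuousOn (Function.uncurry q) (S ×ˢ univ))
    (hom : ∀ p ∈ S, ∀ (a : ℝ) v, q p (a • v) = a ^ 2 * q p v) :
    ∃ C > 0, ∀ p ∈ S, ∀ v, q p v ≤ C * ‖v‖ ^ 2 := by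
  have : ProperSpace E := FiniteDimensional.proper_real E
  have hC : IsCompact (S ×ˢ Metric.sphere (0 : E) 1) := hS.prod (isCompact_sphere 0 1)
  obtain ⟨C, h⟩ := hC.bddAbove_image (hq.mono (prod_mono_right (subset_univ _)))
  refine ⟨max C 1, by positivity, fun p hp v => ?_⟩
  rcases eq_or_ne v 0 with rfl | hv
  · have := hom p hp 0 0
    simp only [zero_smul] at this
    rw [this]; simp
  · have hv' : ‖v‖ ≠ 0 := norm_ne_zero_iff.2 hv
    have h1 := h ⟨(p, ‖v‖⁻¹ • v), ⟨hp, by simp [norm_smul, hv']⟩, rfl⟩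
    simp only [Function.uncurry_apply_pair, hom p hp] at h1
    rw [inv_pow, inv_mul_eq_div, div_le_iff₀ (by positivity)] at h1
    exact h1.trans (mul_le_mul_of_nonneg_right (le_max_left _ _) (sq_nonneg _))

theorem Matrix.PosDef.exists_mul_norm_sq_le {Y : Matrix (Fin n) (Fin n) ℝ} (hY : Y.PosDef) :
    ∃ c > 0, ∀ x : EuclideanSpace ℝ (Fin n), c * ‖x‖ ^ 2 ≤ x.ofLp ⬝ᵥ (Y *ᵥ x.ofLp) := by
  obtain ⟨c, hc, h⟩ := exists_forall_mul_norm_sq_le (E := EuclideanSpace ℝ (Fin n))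
    (S := (univ : Set Unit)) isCompact_univ (q := fun _ x => x.ofLp ⬝ᵥ (Y *ᵥ x.ofLp))
    (by
      have : Continuous fun z : Unit × EuclideanSpace ℝ (Fin n) =>
          z.2.ofLp ⬝ᵥ (Y *ᵥ z.2.ofLp) := by
        have h1 : Continuous fun z : Unit × EuclideanSpace ℝ (Fin n) => z.2.ofLp :=
          (PiLp.continuous_ofLp 2 _).comp continuous_snd
        exact h1.dotProduct (continuous_const.matrix_mulVec h1)
      exact this.continuousOn)
    (fun _ _ a v => by
      simp only [WithLp.ofLp_smul, Matrix.mulVec_smul, dotProduct_smul, smul_dotProduct,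
        smul_eq_mul]
      ring)
    (fun _ _ v hv => by
      have := hY.dotProduct_mulVec_pos (x := v.ofLp) (by simpa using hv)
      simpa using this)
  exact ⟨c, hc, fun x => h () trivial x⟩

theorem Matrix.PosDef.exists_sub_smul_one_posSemidef {Y : Matrix (Fin n) (Fin n) ℝ}
    (hY : Y.PosDef) : ∃ c > 0, (Y - (c : ℝ) • 1).PosSemidef := by
  obtain ⟨c, hc, h⟩ := hY.exists_mul_norm_sq_le
  refine ⟨c, hc, Matrix.PosSemidef.of_dotProduct_mulVec_nonneg ?_ fun x => ?_⟩
  · exact hY.isHermitian.sub (Matrix.isHermitian_one.smul (IsSelfAdjoint.all c))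
  · have := h (WithLp.toLp 2 x)
    rw [EuclideanSpace.real_norm_sq_eq] at this
    simp only [star_trivial, Matrix.sub_mulVec, Matrix.smul_mulVec, Matrix.one_mulVec,
      dotProduct_sub, dotProduct_smul, smul_eq_mul, sub_nonneg]
    refine le_trans (le_of_eq ?_) this
    simp [dotProduct, sq]

/-! ### Real powers of positive definite matrices -/

section symPow

variable {Y : Matrix (Fin n) (Fin n) ℝ}

theorem symPow_mulVec_eigenvectorBasis (hY : Y.IsHermitian) (s : ℝ) (i : Fin n) :
    symPow Y s *ᵥ (hY.eigenvectorBasis i).ofLp =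
      hY.eigenvalues i ^ s • (hY.eigenvectorBasis i).ofLp := by
  rw [symPow, hY.cfc_eq, Matrix.IsHermitian.cfc, Unitary.conjStarAlgAut_apply,
    ← Matrix.mulVec_mulVec, ← Matrix.mulVec_mulVec, hY.star_eigenvectorUnitary_mulVec,
    Matrix.diagonal_mulVec_single, ← hY.eigenvectorUnitary_mulVec, ← Matrix.mulVec_smul]
  congr 1
  ext j
  simp [Pi.single_apply]

theorem Matrix.IsHermitian.ext_of_mulVec_eigenvectorBasis (hY : Y.IsHermitian)
    {M N : Matrix (Fin n) (Fin n) ℝ}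
    (h : ∀ i, M *ᵥ (hY.eigenvectorBasis i).ofLp = N *ᵥ (hY.eigenvectorBasis i).ofLp) : M = N := by
  apply (Matrix.toEuclideanLin (𝕜 := ℝ) (m := Fin n) (n := Fin n)).injective
  refine hY.eigenvectorBasis.toBasis.ext fun i => ?_
  simp only [OrthonormalBasis.coe_toBasis, Matrix.toLpLin_apply, h i]

theorem symPow_mul_symPow (hY : Y.PosDef) (s t : ℝ) :
    symPow Y s * symPow Y t = symPow Y (s + t) := by
  refine hY.isHermitian.ext_of_mulVec_eigenvectorBasis fun i => ?_
  rw [← Matrix.mulVec_mulVec, symPow_mulVec_eigenvectorBasis, Matrix.mulVec_smul,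
    symPow_mulVec_eigenvectorBasis, symPow_mulVec_eigenvectorBasis, smul_smul, add_comm,
    Real.rpow_add (hY.eigenvalues_pos i)]

theorem symPow_zero (hY : Y.PosDef) : symPow Y 0 = 1 := by
  refine hY.isHermitian.ext_of_mulVec_eigenvectorBasis fun i => ?_
  rw [symPow_mulVec_eigenvectorBasis, Real.rpow_zero, one_smul, Matrix.one_mulVec]

theorem symPow_one (hY : Y.PosDef) : symPow Y 1 = Y := by
  refine hY.isHermitian.ext_of_mulVec_eigenvectorBasis fun i => ?_
  rw [symPow_mulVec_eigenvectorBasis, Real.rpow_one, hY.isHermitian.mulVec_eigenvectorBasis]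

/-- `Y ^ s` is the square of the symmetric matrix `Y ^ (s / 2)`, which has the inverse `Y ^ (-(s /
2))`. -/
theorem symPow_posDef (hY : Y.PosDef) (s : ℝ) : (symPow Y s).PosDef := by
  have h1 : symPow Y s = (symPow Y (s / 2))ᴴ * symPow Y (s / 2) := by
    rw [Matrix.conjTranspose_eq_transpose_of_trivial, symPow_transpose, symPow_mul_symPow hY,
      add_halves]
  rw [h1]
  refine Matrix.PosDef.conjTranspose_mul_self _ fun v w hvw => ?_
  have h2 : symPow Y (-(s / 2)) * symPow Y (s / 2) = 1 := by
    rw [symPow_mul_symPow hY, neg_add_cancel, symPow_zero hY]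
  have h3 := congrArg (fun u => symPow Y (-(s / 2)) *ᵥ u) hvw
  simpa only [Matrix.mulVec_mulVec, h2, Matrix.one_mulVec] using h3

end symPow

theorem one_le_radius_binomialSeries_clm (s : ℝ) :
    1 ≤ (binomialSeries (EuclideanSpace ℝ (Fin n) →L[ℝ] EuclideanSpace ℝ (Fin n)) s).radius := by
  refine (binomialSeries_radius_ge_one (𝕂 := ℝ) (𝔸 := ℝ) (a := s)).trans
    (FormalMultilinearSeries.radius_le_of_le fun k => ?_)
  rw [binomialSeries, binomialSeries, FormalMultilinearSeries.ofScalars_norm ℝ]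
  -- Degree zero is separate: on the zero space the identity has norm 0, and only `‖id‖ ≤ 1` holds
  -- in general.
  rcases k.eq_zero_or_pos with rfl | hk
  · refine ContinuousMultilinearMap.opNorm_le_bound (norm_nonneg _) fun v => ?_
    simp only [FormalMultilinearSeries.ofScalars, smul_apply,
      ContinuousMultilinearMap.mkPiAlgebraFin_apply,
      List.ofFn_zero, List.prod_nil, Finset.univ_eq_empty, Finset.prod_empty, mul_one]
    exact (norm_smul_le (Ring.choose s 0) (ContinuousLinearMap.id ℝ (EuclideanSpace ℝ (Fin n)))).trans
      (mul_le_of_le_one_right (norm_nonneg _) ContinuousLinearMap.norm_id_le)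
  · exact FormalMultilinearSeries.ofScalars_norm_le _ _ k hk

/-- `Y ^ s = M ^ s (1 + Z) ^ s` with `Z = M⁻¹ Y - 1`. On an eigenvector of `Y` the operator series
reduces to the scalar binomial series. The right side is analytic in `Y`, whereas eigenvectors need
not depend smoothly on it. -/
theorem toEuclideanCLM_symPow {Y : Matrix (Fin n) (Fin n) ℝ} (hY : Y.PosDef) (s : ℝ) {M : ℝ}
    (hM : 0 < M) (h : ‖Matrix.toEuclideanCLM (𝕜 := ℝ) (M⁻¹ • Y) - 1‖ < 1) :
    Matrix.toEuclideanCLM (𝕜 := ℝ) (symPow Y s) = M ^ s •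
      (binomialSeries (EuclideanSpace ℝ (Fin n) →L[ℝ] EuclideanSpace ℝ (Fin n)) s).sum
        (Matrix.toEuclideanCLM (𝕜 := ℝ) (M⁻¹ • Y) - 1) := by
  set Z := Matrix.toEuclideanCLM (𝕜 := ℝ) (M⁻¹ • Y) - 1 with hZ
  apply ContinuousLinearMap.coe_injective
  refine hY.isHermitian.eigenvectorBasis.toBasis.ext fun i => ?_
  set b := hY.isHermitian.eigenvectorBasis i with hb
  set l := hY.isHermitian.eigenvalues i with hl
  have hl0 : 0 < l := hY.eigenvalues_pos i
  have hbn : ‖b‖ = 1 := hY.isHermitian.eigenvectorBasis.orthonormal.1 i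
  have hZb : Z b = (M⁻¹ * l - 1) • b := by
    have : (Matrix.toEuclideanCLM (𝕜 := ℝ) (M⁻¹ • Y)) b = (M⁻¹ * l) • b := by
      apply WithLp.ofLp_injective 2
      rw [Matrix.ofLp_toEuclideanCLM, Matrix.smul_mulVec,
        hY.isHermitian.mulVec_eigenvectorBasis, smul_smul]
      rfl
    rw [hZ, sub_apply, this, sub_smul, one_smul]
    rfl
  have hz : |M⁻¹ * l - 1| < 1 := by
    have h1 := Z.le_opNorm b
    rw [hZb, norm_smul, hbn, mul_one, mul_one, Real.norm_eq_abs] at h1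
    exact h1.trans_lt h
  have hpow : ∀ k : ℕ, (Z ^ k) b = (M⁻¹ * l - 1) ^ k • b := by
    intro k
    induction k with
    | zero => simp
    | succ k ih =>
      rw [pow_succ, mul_apply_eq_comp, hZb, map_smul, ih, smul_smul, pow_succ, mul_comm]
  have hZmem : Z ∈ Metric.eball 0
      (binomialSeries (EuclideanSpace ℝ (Fin n) →L[ℝ] EuclideanSpace ℝ (Fin n)) s).radius := by
    refine Metric.eball_subset_eball (one_le_radius_binomialSeries_clm s) ?_
    rw [← ENNReal.ofReal_one, Metric.eball_ofReal]
    simpa using h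
  have h1 := (FormalMultilinearSeries.hasSum _ hZmem).mapL
    (ContinuousLinearMap.apply ℝ (EuclideanSpace ℝ (Fin n)) b)
  have h2 := (Real.one_add_rpow_hasFPowerSeriesOnBall_zero (a := s)).hasSum
    (y := M⁻¹ * l - 1) (by
      rw [← ENNReal.ofReal_one, Metric.eball_ofReal]
      simpa using hz)
  have h3 := h2.smul_const b
  have h4 : (binomialSeries (EuclideanSpace ℝ (Fin n) →L[ℝ] EuclideanSpace ℝ (Fin n)) s).sum Z b
      = (M⁻¹ * l) ^ s • b := by
    rw [zero_add, add_sub_cancel] at h3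
    have h5 : ∀ k, (binomialSeries (EuclideanSpace ℝ (Fin n) →L[ℝ] EuclideanSpace ℝ (Fin n)) s k
        fun _ => Z) b = (binomialSeries ℝ s k fun _ => M⁻¹ * l - 1) • b := fun k => by
      simp only [binomialSeries, FormalMultilinearSeries.ofScalars_apply_eq, smul_apply, hpow,
        smul_eq_mul, smul_smul]
    simp only [← h5] at h3
    exact h1.unique h3
  rw [OrthonormalBasis.coe_toBasis]
  change Matrix.toEuclideanCLM (𝕜 := ℝ) (symPow Y s) b = M ^ s • (binomialSeries
    (EuclideanSpace ℝ (Fin n) →L[ℝ] EuclideanSpace ℝ (Fin n)) s).sum Z b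
  rw [h4, smul_smul, ← Real.mul_rpow hM.le (by positivity), mul_inv_cancel_left₀ hM.ne']
  apply WithLp.ofLp_injective 2
  rw [Matrix.ofLp_toEuclideanCLM, symPow_mulVec_eigenvectorBasis]
  rfl

theorem Matrix.PosDef.exists_norm_toEuclideanCLM_sub_one_lt {Y : Matrix (Fin n) (Fin n) ℝ}
    (hY : Y.PosDef) : ∃ M : ℝ, 0 < M ∧ ‖Matrix.toEuclideanCLM (𝕜 := ℝ) (M⁻¹ • Y) - 1‖ < 1 := by
  obtain ⟨σ, hσ, h⟩ := hY.exists_mul_norm_sq_le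
  set c := ‖Matrix.toEuclideanCLM (𝕜 := ℝ) Y‖ with hc
  -- Chosen so that `c ^ 2 ≤ σ * M`: when `‖M⁻¹ Y x - x‖ ^ 2` is expanded, the quadratic term
  -- consumes at most half of the gain `2 M⁻¹ σ ‖x‖ ^ 2` from the cross term.
  set M : ℝ := (c ^ 2 + 1) / σ with hM
  have hM0 : 0 < M := by positivity
  have hσM : σ * M = c ^ 2 + 1 := by rw [hM]; field_simp
  have hlt : 1 - M⁻¹ * σ < 1 := by
    have : 0 < M⁻¹ * σ := by positivity
    linarith
  refine ⟨M, hM0, lt_of_le_of_lt (ContinuousLinearMap.opNorm_le_bound _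
    (Real.sqrt_nonneg (1 - M⁻¹ * σ)) fun x => ?_) ((Real.sqrt_lt' one_pos).2 (by simpa using hlt))⟩
  have hx := h x
  have h1 : (Matrix.toEuclideanCLM (𝕜 := ℝ) (M⁻¹ • Y) - 1) x
      = M⁻¹ • Matrix.toEuclideanCLM (𝕜 := ℝ) Y x - x := by
    rw [map_smul]; rfl
  have h2 : inner ℝ (Matrix.toEuclideanCLM (𝕜 := ℝ) Y x) x = x.ofLp ⬝ᵥ (Y *ᵥ x.ofLp) := by
    rw [EuclideanSpace.inner_eq_star_dotProduct, star_trivial, Matrix.ofLp_toEuclideanCLM]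
  have h3 : ‖Matrix.toEuclideanCLM (𝕜 := ℝ) Y x‖ ^ 2 ≤ c ^ 2 * ‖x‖ ^ 2 := by
    rw [← mul_pow]
    exact pow_le_pow_left₀ (norm_nonneg _) (ContinuousLinearMap.le_opNorm _ x) 2
  have h4 : ‖M⁻¹ • Matrix.toEuclideanCLM (𝕜 := ℝ) Y x - x‖ ^ 2 ≤ (1 - M⁻¹ * σ) * ‖x‖ ^ 2 := by
    rw [norm_sub_sq_real, inner_smul_left, norm_smul, mul_pow, h2]
    simp only [Real.norm_eq_abs, sq_abs, conj_trivial]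
    have h5 : M⁻¹ ^ 2 * ‖Matrix.toEuclideanCLM (𝕜 := ℝ) Y x‖ ^ 2 ≤ M⁻¹ * σ * ‖x‖ ^ 2 := by
      calc M⁻¹ ^ 2 * ‖Matrix.toEuclideanCLM (𝕜 := ℝ) Y x‖ ^ 2
          ≤ M⁻¹ ^ 2 * ((σ * M) * ‖x‖ ^ 2) := by
            gcongr
            refine h3.trans (mul_le_mul_of_nonneg_right ?_ (sq_nonneg _))
            rw [hσM]; linarith
        _ = M⁻¹ * σ * ‖x‖ ^ 2 * (M⁻¹ * M) := by ring
        _ = M⁻¹ * σ * ‖x‖ ^ 2 := by rw [inv_mul_cancel₀ hM0.ne', mul_one]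
    have h6 : M⁻¹ * (σ * ‖x‖ ^ 2) ≤ M⁻¹ * (x.ofLp ⬝ᵥ (Y *ᵥ x.ofLp)) := by gcongr
    nlinarith
  rw [h1]
  have := Real.sqrt_le_sqrt h4
  rwa [Real.sqrt_sq (norm_nonneg _), Real.sqrt_mul' _ (sq_nonneg _),
    Real.sqrt_sq (norm_nonneg _)] at this

theorem ContDiffAt.symPow {E : Type*} [NormedAddCommGroup E] [NormedSpace ℝ E]
    {k : ℕ∞ω} {F : E → Matrix (Fin n) (Fin n) ℝ} {x : E} (hF : ContDiffAt ℝ k F x)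
    (hpos : ∀ᶠ y in 𝓝 x, (F y).PosDef) (s : ℝ) :
    ContDiffAt ℝ k (fun y => symPow (F y) s) x := by
  -- One scale `M`, chosen at `x`, serves a whole neighbourhood because the inequality is strict.
  obtain ⟨M, hM, hlt⟩ := hpos.self_of_nhds.exists_norm_toEuclideanCLM_sub_one_lt
  let T : Matrix (Fin n) (Fin n) ℝ →ₗ[ℝ]
      (EuclideanSpace ℝ (Fin n) →L[ℝ] EuclideanSpace ℝ (Fin n)) :=
    { toFun := Matrix.toEuclideanCLM (𝕜 := ℝ) (n := Fin n)
      map_add' := map_add _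
      map_smul' := map_smul _ }
  let T' : (EuclideanSpace ℝ (Fin n) →L[ℝ] EuclideanSpace ℝ (Fin n)) →ₗ[ℝ]
      Matrix (Fin n) (Fin n) ℝ :=
    { toFun := (Matrix.toEuclideanCLM (𝕜 := ℝ) (n := Fin n)).symm
      map_add' := map_add _
      map_smul' := map_smul _ }
  have hZ : ContDiffAt ℝ k (fun y => T.toContinuousLinearMap (M⁻¹ • F y) - 1) x :=
    (T.toContinuousLinearMap.contDiff.contDiffAt.comp x (hF.const_smul M⁻¹)).sub contDiffAt_const
  have hrad := one_le_radius_binomialSeries_clm (n := n) s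
  have hmem : (T.toContinuousLinearMap (M⁻¹ • F x) - 1) ∈ Metric.eball 0
      (binomialSeries (EuclideanSpace ℝ (Fin n) →L[ℝ] EuclideanSpace ℝ (Fin n)) s).radius := by
    refine Metric.eball_subset_eball hrad ?_
    rw [← ENNReal.ofReal_one, Metric.eball_ofReal]
    rw [mem_ball_zero_iff]
    exact hlt
  have hsum := ((FormalMultilinearSeries.hasFPowerSeriesOnBall _
    (lt_of_lt_of_le one_pos hrad)).analyticAt_of_mem hmem).contDiffAt (n := k)
  have h1 := (T'.toContinuousLinearMap.contDiff (n := k)).contDiffAt.comp x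
    ((hsum.comp x hZ).const_smul (M ^ s))
  refine h1.congr_of_eventuallyEq ?_
  have hev : ∀ᶠ y in 𝓝 x, ‖T.toContinuousLinearMap (M⁻¹ • F y) - 1‖ < 1 :=
    hZ.continuousAt.norm.eventually_lt_const hlt
  filter_upwards [hpos, hev] with y hy hy'
  have h2 := toEuclideanCLM_symPow hy s hM hy'
  have h3 := congrArg (Matrix.toEuclideanCLM (𝕜 := ℝ) (n := Fin n)).symm h2
  rw [StarAlgEquiv.symm_apply_apply] at h3
  exact h3

/-! ### Smoothness of matrix operations and weighted trace bounds -/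

theorem isBoundedBilinearMap_matrix_mul {k l r : ℕ} :
    IsBoundedBilinearMap ℝ
      (fun p : Matrix (Fin k) (Fin l) ℝ × Matrix (Fin l) (Fin r) ℝ => p.1 * p.2) where
  add_left := fun _ _ _ => Matrix.add_mul _ _ _
  smul_left := fun _ _ _ => Matrix.smul_mul _ _ _
  add_right := fun _ _ _ => Matrix.mul_add _ _ _
  smul_right := fun _ _ _ => Matrix.mul_smul _ _ _
  bound := ⟨1, one_pos, fun M N => by simpa using Matrix.frobenius_norm_mul M N⟩

section calculus

variable {E : Type*} [NormedAddCommGroup E] [NormedSpace ℝ E] {x : E} {r : ℕ∞ω}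

theorem ContDiffAt.matrix_mul {k l j : ℕ} {F : E → Matrix (Fin k) (Fin l) ℝ}
    {G : E → Matrix (Fin l) (Fin j) ℝ} (hF : ContDiffAt ℝ r F x) (hG : ContDiffAt ℝ r G x) :
    ContDiffAt ℝ r (fun y => F y * G y) x :=
  isBoundedBilinearMap_matrix_mul.contDiff.contDiffAt.comp x (hF.prodMk hG)

theorem ContDiffAt.matrix_transpose {k l : ℕ} {F : E → Matrix (Fin k) (Fin l) ℝ}
    (hF : ContDiffAt ℝ r F x) : ContDiffAt ℝ r (fun y => (F y)ᵀ) x :=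
  (LinearMap.toContinuousLinearMap
    (Matrix.transposeLinearEquiv (Fin k) (Fin l) ℝ ℝ).toLinearMap).contDiff.contDiffAt.comp x hF

theorem ContDiffAt.matrix_trace {F : E → Matrix (Fin n) (Fin n) ℝ}
    (hF : ContDiffAt ℝ r F x) : ContDiffAt ℝ r (fun y => (F y).trace) x :=
  (LinearMap.toContinuousLinearMap
    (Matrix.traceLinearMap (Fin n) ℝ ℝ)).contDiff.contDiffAt.comp x hF

end calculus

theorem Matrix.PosSemidef.conj_transpose {S : Matrix (Fin m) (Fin m) ℝ} (hS : S.PosSemidef)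
    (M : Matrix (Fin m) (Fin n) ℝ) : (Mᵀ * S * M).PosSemidef := by
  simpa using hS.conjTranspose_mul_mul_same M

theorem Matrix.PosDef.exists_mul_norm_sq_le_trace {S : Matrix (Fin n) (Fin n) ℝ}
    (hS : S.PosDef) : ∃ c > 0, ∀ {k : ℕ} (M : Matrix (Fin k) (Fin n) ℝ),
      c * ‖M‖ ^ 2 ≤ (Mᵀ * M * S).trace := by
  obtain ⟨c, hc, h⟩ := hS.exists_sub_smul_one_posSemidef
  refine ⟨c, hc, fun M => ?_⟩
  have h1 : (Mᵀ * M).PosSemidef := by simpa using Matrix.PosSemidef.one.conj_transpose M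
  have h2 := h1.trace_mul_nonneg h
  rw [Matrix.mul_sub, Matrix.trace_sub, Matrix.mul_smul, Matrix.trace_smul, Matrix.mul_one,
    ← Matrix.frobenius_norm_sq, smul_eq_mul] at h2
  linarith

theorem Matrix.PosDef.exists_trace_conj_le {R : Matrix (Fin m) (Fin m) ℝ} (hR : R.PosDef) :
    ∃ ρ > 0, ∀ (M : Matrix (Fin m) (Fin n) ℝ) {Y : Matrix (Fin n) (Fin n) ℝ}, Y.PosSemidef →
      ρ * (Mᵀ * M * Y).trace ≤ (Mᵀ * R * M * Y).trace := by
  obtain ⟨ρ, hρ, h⟩ := hR.exists_sub_smul_one_posSemidef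
  refine ⟨ρ, hρ, fun M Y hY => ?_⟩
  have h2 := (h.conj_transpose M).trace_mul_nonneg hY
  rw [Matrix.mul_sub, Matrix.sub_mul, Matrix.sub_mul, Matrix.trace_sub, Matrix.mul_smul,
    Matrix.smul_mul, Matrix.smul_mul, Matrix.trace_smul, Matrix.mul_one, smul_eq_mul] at h2
  linarith

theorem Matrix.PosDef.trace_pos_of_ne_zero {S : Matrix (Fin n) (Fin n) ℝ} (hS : S.PosDef)
    {M : Matrix (Fin m) (Fin n) ℝ} (hM : M ≠ 0) : 0 < (Mᵀ * M * S).trace := by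
  obtain ⟨c, hc, h⟩ := hS.exists_mul_norm_sq_le_trace
  refine lt_of_lt_of_le ?_ (h M)
  have := norm_pos_iff.2 hM
  positivity

/-! ### Value matrix, Gramian and the cost difference identity -/

namespace LQR

variable {P : LQR n m} {K : Matrix (Fin m) (Fin n) ℝ}

theorem valueMatrix_eq (P : LQR n m) (K : Matrix (Fin m) (Fin n) ℝ) :
    P.valueMatrix K = lyapunovIntegral (P.closedLoop K)ᵀ (Kᵀ * P.R * K + P.Q) := rfl

theorem gramian_eq (P : LQR n m) (K : Matrix (Fin m) (Fin n) ℝ) :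
    P.gramian K = lyapunovIntegral (P.closedLoop K) P.initCov := rfl

theorem valueMatrix_iff (hK : K ∈ P.stabilizing) (X : Matrix (Fin n) (Fin n) ℝ) :
    (P.closedLoop K)ᵀ * X + X * P.closedLoop K + Kᵀ * P.R * K + P.Q = 0
      ↔ X = P.valueMatrix K := by
  rw [valueMatrix_eq, ← IsHurwitz.lyapunov_iff (IsHurwitz.transpose hK),
    Matrix.transpose_transpose, add_assoc]

theorem gramian_iff (hK : K ∈ P.stabilizing) (Y : Matrix (Fin n) (Fin n) ℝ) :
    P.closedLoop K * Y + Y * (P.closedLoop K)ᵀ + P.initCov = 0 ↔ Y = P.gramian K :=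
  IsHurwitz.lyapunov_iff hK P.initCov Y

theorem dotProduct_initCov_mulVec (P : LQR n m) (x : Fin n → ℝ) :
    x ⬝ᵥ (P.initCov *ᵥ x) = ∑ j, (P.x₀ j ⬝ᵥ x) ^ 2 := by
  rw [initCov, Matrix.sum_mulVec, dotProduct_sum]
  refine Finset.sum_congr rfl fun j _ => ?_
  rw [Matrix.vecMulVec_mulVec]
  simp [dotProduct_comm x, sq]

theorem Standard.initCov_posDef (hP : P.Standard) : P.initCov.PosDef := by
  refine Matrix.PosDef.of_dotProduct_mulVec_pos ?_ fun x hx => ?_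
  · rw [Matrix.IsHermitian, Matrix.conjTranspose_eq_transpose_of_trivial, initCov,
      Matrix.transpose_sum]
    simp only [Matrix.transpose_vecMulVec]
  · rw [star_trivial, dotProduct_initCov_mulVec]
    refine lt_of_le_of_ne (Finset.sum_nonneg fun j _ => sq_nonneg _) fun h => hx ?_
    have h1 : ∀ j, P.x₀ j ⬝ᵥ x = 0 := fun j => by
      have := (Finset.sum_eq_zero_iff_of_nonneg (fun j _ => sq_nonneg (P.x₀ j ⬝ᵥ x))).1 h.symm j
        (Finset.mem_univ j)
      exact pow_eq_zero_iff two_ne_zero |>.1 this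
    have h2 : ∀ y ∈ Submodule.span ℝ (Set.range P.x₀), y ⬝ᵥ x = 0 := by
      intro y hy
      induction hy using Submodule.span_induction with
      | mem y hy => obtain ⟨j, rfl⟩ := hy; exact h1 j
      | zero => simp
      | add y z _ _ hy hz => rw [add_dotProduct, hy, hz, add_zero]
      | smul a y _ hy => rw [smul_dotProduct, hy, smul_zero]
    rw [hP.spanning] at h2
    exact dotProduct_self_eq_zero.1 (h2 x trivial)

theorem Standard.runningCost_posSemidef (hP : P.Standard) (K : Matrix (Fin m) (Fin n) ℝ) :
    (Kᵀ * P.R * K + P.Q).PosSemidef :=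
  (hP.posDef_R.posSemidef.conj_transpose K).add hP.posSemidef_Q

theorem Standard.valueMatrix_posSemidef (hP : P.Standard) (hK : K ∈ P.stabilizing) :
    (P.valueMatrix K).PosSemidef :=
  (IsHurwitz.transpose hK).lyapunovIntegral_posSemidef (hP.runningCost_posSemidef K)

/-- A lower bound of the Gramian in terms of the size of the closed-loop matrix. -/
theorem gramian_sub_smul_one_posSemidef (hK : K ∈ P.stabilizing) {σ ε : ℝ}
    (hσ : (P.initCov - σ • 1).PosSemidef) (hε : 0 ≤ ε) (h : 2 * ε * ‖P.closedLoop K‖ ≤ σ) :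
    (P.gramian K - ε • 1).PosSemidef := by
  rw [gramian_eq]
  refine IsHurwitz.lyapunovIntegral_sub_smul_one_posSemidef hK ?_
  set A := P.closedLoop K
  refine Matrix.PosSemidef.of_dotProduct_mulVec_nonneg ?_ fun x => ?_
  · have h1 : P.initCov.IsHermitian := by
      have := hσ.isHermitian.add (Matrix.isHermitian_one.smul (IsSelfAdjoint.all σ))
      rwa [sub_add_cancel] at this
    refine h1.add (Matrix.IsHermitian.smul ?_ (IsSelfAdjoint.all ε))
    rw [Matrix.IsHermitian, Matrix.conjTranspose_eq_transpose_of_trivial, Matrix.transpose_add,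
      Matrix.transpose_transpose, add_comm]
  · have h1 := hσ.dotProduct_mulVec_nonneg x
    have h2 : x ⬝ᵥ (Aᵀ *ᵥ x) = x ⬝ᵥ (A *ᵥ x) := by
      rw [Matrix.dotProduct_mulVec, Matrix.vecMul_transpose, dotProduct_comm]
    have h3 : |x ⬝ᵥ (A *ᵥ x)| ≤ ‖A‖ * (x ⬝ᵥ x) := by
      -- With the vector as a one-column matrix, the bound is submultiplicativity of the Frobenius
      -- norm.
      let c : Matrix (Fin n) (Fin 1) ℝ := Matrix.replicateCol (Fin 1) x
      have e1 : x ⬝ᵥ (A *ᵥ x) = (cᵀ * (A * c)) 0 0 := by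
        simp [c, Matrix.mul_apply, dotProduct, Matrix.mulVec]
      have e2 : ∀ M : Matrix (Fin 1) (Fin 1) ℝ, |M 0 0| ≤ ‖M‖ := by
        intro M
        have : ‖M‖ ^ 2 = (M 0 0) ^ 2 := by
          rw [Matrix.frobenius_norm_sq]
          simp [Matrix.trace, Matrix.mul_apply, sq]
        exact abs_le_of_sq_le_sq this.ge (norm_nonneg _)
      have e3 : x ⬝ᵥ x = ‖c‖ ^ 2 := by
        rw [Matrix.frobenius_norm_sq]
        simp [c, Matrix.trace, Matrix.mul_apply, dotProduct]
      rw [e1, e3]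
      refine (e2 _).trans ((Matrix.frobenius_norm_mul _ _).trans ?_)
      rw [Matrix.frobenius_norm_transpose]
      calc ‖c‖ * ‖A * c‖ ≤ ‖c‖ * (‖A‖ * ‖c‖) :=
            mul_le_mul_of_nonneg_left (Matrix.frobenius_norm_mul _ _) (norm_nonneg _)
        _ = ‖A‖ * ‖c‖ ^ 2 := by ring
    have h4 : 0 ≤ x ⬝ᵥ x := dotProduct_self_star_nonneg x
    simp only [star_trivial, Matrix.sub_mulVec, Matrix.smul_mulVec, Matrix.one_mulVec,
      dotProduct_sub, dotProduct_smul, smul_eq_mul, Matrix.add_mulVec, dotProduct_add, h2]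
      at h1 ⊢
    have h5 := (abs_le.1 h3).1
    have h6 : ε * (-(‖A‖ * (x ⬝ᵥ x))) ≤ ε * (x ⬝ᵥ (A *ᵥ x)) := mul_le_mul_of_nonneg_left h5 hε
    have h7 : 2 * ε * ‖A‖ * (x ⬝ᵥ x) ≤ σ * (x ⬝ᵥ x) := mul_le_mul_of_nonneg_right h h4
    nlinarith

theorem Standard.gramian_posDef (hP : P.Standard) (hK : K ∈ P.stabilizing) :
    (P.gramian K).PosDef := by
  obtain ⟨σ, hσ, h⟩ := hP.initCov_posDef.exists_sub_smul_one_posSemidef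
  have hε : 0 < σ / (2 * (‖P.closedLoop K‖ + 1)) := by positivity
  have h1 := gramian_sub_smul_one_posSemidef hK h hε.le (by
    rw [div_eq_mul_inv, mul_inv]
    have : ‖P.closedLoop K‖ * (‖P.closedLoop K‖ + 1)⁻¹ ≤ 1 := by
      rw [← div_eq_mul_inv, div_le_one (by positivity)]
      linarith
    nlinarith)
  have h2 := Matrix.PosDef.add_posSemidef (Matrix.PosDef.one.smul hε) h1
  rwa [add_sub_cancel] at h2

theorem costFrom_eq (hK : K ∈ P.stabilizing) (x : Fin n → ℝ) :
    P.costFrom K x = x ⬝ᵥ (P.valueMatrix K *ᵥ x) := by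
  rw [valueMatrix_eq, (IsHurwitz.transpose hK).dotProduct_lyapunovIntegral_mulVec, costFrom]
  refine integral_congr_ae (Eventually.of_forall fun t => ?_)
  change P.state K x t ⬝ᵥ (P.Q *ᵥ P.state K x t)
      + (-(K *ᵥ P.state K x t)) ⬝ᵥ (P.R *ᵥ (-(K *ᵥ P.state K x t)))
    = P.state K x t ⬝ᵥ ((Kᵀ * P.R * K + P.Q) *ᵥ P.state K x t)
  rw [Matrix.mulVec_neg, neg_dotProduct_neg, Matrix.add_mulVec, dotProduct_add, add_comm,
    ← Matrix.mulVec_mulVec, ← Matrix.mulVec_mulVec, Matrix.dotProduct_mulVec _ Kᵀ,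
    Matrix.vecMul_transpose]

theorem cost_eq_trace (hK : K ∈ P.stabilizing) :
    P.cost K = (P.valueMatrix K * P.initCov).trace := by
  rw [cost, initCov, Finset.mul_sum, Matrix.trace_sum]
  refine Finset.sum_congr rfl fun j _ => ?_
  rw [costFrom_eq hK, Matrix.mul_vecMulVec, Matrix.trace_vecMulVec, dotProduct_comm]

theorem cost_eq_trace_gramian (hK : K ∈ P.stabilizing) :
    P.cost K = ((Kᵀ * P.R * K + P.Q) * P.gramian K).trace := by
  rw [cost_eq_trace hK, valueMatrix_eq, IsHurwitz.trace_lyapunovIntegral_mul hK, gramian_eq]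

/-- `X_L - X_K` solves the Lyapunov equation of `L` whose source is the bracket on the right;
adjointness then moves the integral from this source onto `Σ`, where it becomes `Y_L`. -/
theorem Standard.cost_sub_cost (hP : P.Standard) (hK : K ∈ P.stabilizing)
    {L : Matrix (Fin m) (Fin n) ℝ} (hL : L ∈ P.stabilizing) :
    P.cost L - P.cost K = (((L - K)ᵀ * P.R * (L - K) + (L - K)ᵀ * P.residual K
      + (P.residual K)ᵀ * (L - K)) * P.gramian L).trace := by
  have hX : (P.valueMatrix K)ᵀ = P.valueMatrix K := (hP.valueMatrix_posSemidef hK).isHermitian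
  have hR : P.Rᵀ = P.R := hP.posDef_R.isHermitian
  have h1 := (valueMatrix_iff hK _).2 rfl
  have h2 := (valueMatrix_iff hL _).2 rfl
  rw [cost_eq_trace hK, cost_eq_trace hL, ← Matrix.trace_sub, ← Matrix.sub_mul, gramian_eq,
    ← IsHurwitz.trace_lyapunovIntegral_mul hL]
  congr 2
  refine (IsHurwitz.transpose hL).eq_lyapunovIntegral ?_
  -- The zero on the right becomes the difference of the two Lyapunov equations, leaving an
  -- algebraic identity.
  rw [← sub_self (0 : Matrix (Fin n) (Fin n) ℝ)]
  nth_rewrite 1 [← h2]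
  rw [← h1]
  simp only [residual, closedLoop, Matrix.transpose_sub, Matrix.transpose_mul, hX, hR,
    Matrix.transpose_transpose, Matrix.sub_mul, Matrix.mul_sub, Matrix.mul_assoc]
  abel

end LQR

/-! ### Smoothness of the cost, metric and gradient -/

namespace LQR

variable {P : LQR n m} {K : Matrix (Fin m) (Fin n) ℝ}

theorem contDiff_closedLoop {k : ℕ∞ω} : ContDiff ℝ k P.closedLoop :=
  contDiff_const.sub (contDiff_iff_contDiffAt.2 fun _ => contDiffAt_const.matrix_mul contDiffAt_id)

theorem isOpen_stabilizing (P : LQR n m) : IsOpen P.stabilizing :=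
  isOpen_setOf_isHurwitz.preimage (contDiff_closedLoop (k := 0)).continuous

theorem contDiffAt_gramian {k : ℕ∞ω} (hK : K ∈ P.stabilizing) : ContDiffAt ℝ k P.gramian K :=
  ContDiffAt.lyapunovIntegral hK contDiff_closedLoop.contDiffAt contDiffAt_const

theorem contDiffAt_runningCost (P : LQR n m) {k : ℕ∞ω} (K : Matrix (Fin m) (Fin n) ℝ) :
    ContDiffAt ℝ k (fun K : Matrix (Fin m) (Fin n) ℝ => Kᵀ * P.R * K + P.Q) K :=
  ((contDiffAt_id.matrix_transpose.matrix_mul contDiffAt_const).matrix_mul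
    contDiffAt_id).add contDiffAt_const

theorem contDiffAt_valueMatrix {k : ℕ∞ω} (hK : K ∈ P.stabilizing) :
    ContDiffAt ℝ k P.valueMatrix K :=
  ContDiffAt.lyapunovIntegral (A := fun K => (P.closedLoop K)ᵀ) (IsHurwitz.transpose hK)
    contDiff_closedLoop.contDiffAt.matrix_transpose
    (P.contDiffAt_runningCost K)

theorem contDiffAt_residual {k : ℕ∞ω} (hK : K ∈ P.stabilizing) : ContDiffAt ℝ k P.residual K :=
  (contDiffAt_const.matrix_mul contDiffAt_id).sub
    (contDiffAt_const.matrix_mul (contDiffAt_valueMatrix hK))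

theorem contDiffAt_cost {k : ℕ∞ω} (hK : K ∈ P.stabilizing) : ContDiffAt ℝ k P.cost K := by
  refine ContDiffAt.congr_of_eventuallyEq
    ((P.contDiffAt_runningCost K).matrix_mul (contDiffAt_gramian hK)).matrix_trace ?_
  filter_upwards [P.isOpen_stabilizing.mem_nhds hK] with L hL
  exact cost_eq_trace_gramian hL

theorem Standard.contDiffAt_symPow_gramian (hP : P.Standard) {k : ℕ∞ω} (hK : K ∈ P.stabilizing)
    (s : ℝ) : ContDiffAt ℝ k (fun K => symPow (P.gramian K) s) K :=
  (contDiffAt_gramian hK).symPow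
    ((P.isOpen_stabilizing.eventually_mem hK).mono fun _ hL => hP.gramian_posDef hL) s

theorem differentiableAt_cost (hK : K ∈ P.stabilizing) : DifferentiableAt ℝ P.cost K :=
  (contDiffAt_cost (k := 1) hK).differentiableAt one_ne_zero

/-- On the line `K + t V` the exact difference identity reads `f = f(K) + t g(t)` with `g`
differentiable at 0, so the derivative is `g 0`, and neither `X` nor `Y` has to be differentiated
explicitly. -/
theorem Standard.fderiv_cost (hP : P.Standard) (hK : K ∈ P.stabilizing)
    (V : Matrix (Fin m) (Fin n) ℝ) :
    fderiv ℝ P.cost K V = 2 * ((P.residual K)ᵀ * V * P.gramian K).trace := by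
  set N := P.residual K
  let γ : ℝ → Matrix (Fin m) (Fin n) ℝ := fun t => K + t • V
  have hγ0 : γ 0 = K := by simp [γ]
  have hγ : ContDiffAt ℝ 1 γ 0 := contDiffAt_const.add (contDiffAt_id.smul contDiffAt_const)
  have hγd : HasDerivAt γ V 0 := by
    have := ((hasDerivAt_id (0 : ℝ)).smul_const V).const_add K
    rwa [one_smul] at this
  let g : ℝ → ℝ := fun t =>
    ((t • (Vᵀ * P.R * V) + (Vᵀ * N + Nᵀ * V)) * P.gramian (γ t)).trace
  have hYγ : ContDiffAt ℝ 1 (fun t => P.gramian (γ t)) 0 :=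
    ContDiffAt.comp (g := P.gramian) 0 (by rw [hγ0]; exact contDiffAt_gramian hK) hγ
  have hg : ContDiffAt ℝ 1 g 0 :=
    (((contDiffAt_id.smul contDiffAt_const).add contDiffAt_const).matrix_mul hYγ).matrix_trace
  have h1 : HasDerivAt (fun t => P.cost (γ t)) (fderiv ℝ P.cost K V) 0 := by
    have hd := (differentiableAt_cost hK).hasFDerivAt
    rw [← hγ0] at hd
    have := hd.comp_hasDerivAt 0 hγd
    rwa [hγ0] at this
  have h2 : HasDerivAt (fun t => P.cost K + t * g t) (g 0) 0 := by
    have := ((hasDerivAt_id (0 : ℝ)).mul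
      (hg.differentiableAt one_ne_zero).hasDerivAt).const_add (P.cost K)
    simpa using this
  have h3 : (fun t => P.cost (γ t)) =ᶠ[𝓝 0] fun t => P.cost K + t * g t := by
    have hev : ∀ᶠ t in 𝓝 (0 : ℝ), γ t ∈ P.stabilizing :=
      hγ.continuousAt.eventually_mem (by rw [hγ0]; exact P.isOpen_stabilizing.mem_nhds hK)
    filter_upwards [hev] with t ht
    have h4 := hP.cost_sub_cost hK ht
    have h5 : γ t - K = t • V := by simp [γ]
    rw [← sub_eq_iff_eq_add', h4, h5]
    simp only [g, ← smul_eq_mul (a := t), ← Matrix.trace_smul, ← Matrix.smul_mul,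
      Matrix.transpose_smul, Matrix.mul_smul, smul_add, smul_smul]
    congr 2
    simp only [N]
    abel
  have h6 := (h1.congr_of_eventuallyEq h3.symm).unique h2
  have hY : (P.gramian K)ᵀ = P.gramian K := (hP.gramian_posDef hK).isHermitian
  have h7 : (Vᵀ * N * P.gramian K).trace = (Nᵀ * V * P.gramian K).trace := by
    rw [← Matrix.trace_transpose, Matrix.transpose_mul, Matrix.transpose_mul, hY,
      Matrix.transpose_transpose, Matrix.trace_mul_comm]
  rw [h6]
  simp only [g, zero_smul, hγ0, Matrix.add_mul, Matrix.trace_add, h7, Matrix.zero_mul,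
    Matrix.trace_zero]
  ring

theorem metric_apply (P : LQR n m) (γ : ℝ) (K M N : Matrix (Fin m) (Fin n) ℝ) :
    P.metric γ K M N = (Mᵀ * N * symPow (P.gramian K) γ).trace := rfl

theorem Standard.isRiemannianMetricOn (hP : P.Standard) (γ : ℝ) :
    IsRiemannianMetricOn P.stabilizing (P.metric γ) where
  isOpen := P.isOpen_stabilizing
  add_left := fun K _ v v' w => by
    simp only [metric_apply, Matrix.transpose_add, Matrix.add_mul, Matrix.trace_add]
  smul_left := fun K _ a v w => by
    simp only [metric_apply, Matrix.transpose_smul, Matrix.smul_mul, Matrix.trace_smul,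
      smul_eq_mul]
  symm := fun K _ v w => by
    rw [metric_apply, ← Matrix.trace_transpose, Matrix.transpose_mul, Matrix.transpose_mul,
      symPow_transpose, Matrix.transpose_transpose, Matrix.trace_mul_comm, metric_apply]
  pos := fun K hK v hv => (symPow_posDef (hP.gramian_posDef hK) γ).trace_pos_of_ne_zero hv
  smooth := fun v w K hK =>
    (contDiffAt_const.matrix_mul
      (hP.contDiffAt_symPow_gramian hK γ)).matrix_trace.contDiffWithinAt

/-- The Riemannian gradient of the cost. -/
def naturalGradient (P : LQR n m) (γ : ℝ) (K : Matrix (Fin m) (Fin n) ℝ) :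
    Matrix (Fin m) (Fin n) ℝ :=
  (2 : ℝ) • (P.residual K * symPow (P.gramian K) (1 - γ))

theorem Standard.metric_naturalGradient (hP : P.Standard) (γ : ℝ) (hK : K ∈ P.stabilizing)
    (V : Matrix (Fin m) (Fin n) ℝ) :
    P.metric γ K (P.naturalGradient γ K) V = fderiv ℝ P.cost K V := by
  have hY := hP.gramian_posDef hK
  rw [hP.fderiv_cost hK, metric_apply, naturalGradient, Matrix.transpose_smul, Matrix.smul_mul,
    Matrix.smul_mul, Matrix.trace_smul, smul_eq_mul, Matrix.transpose_mul, symPow_transpose,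
    Matrix.mul_assoc, Matrix.mul_assoc, Matrix.trace_mul_comm, Matrix.mul_assoc, Matrix.mul_assoc,
    symPow_mul_symPow hY, add_sub_cancel, symPow_one hY, ← Matrix.mul_assoc]

/-- Uniqueness is definiteness of the metric: the difference of two gradients is orthogonal to
itself. -/
theorem Standard.isRiemannianGradientAt_iff (hP : P.Standard) (γ : ℝ) (hK : K ∈ P.stabilizing)
    (G : Matrix (Fin m) (Fin n) ℝ) :
    IsRiemannianGradientAt (P.metric γ) P.cost K G ↔ G = P.naturalGradient γ K := by
  constructor
  · rintro ⟨-, h⟩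
    by_contra hne
    have h1 := (hP.isRiemannianMetricOn γ).pos K hK _ (sub_ne_zero.2 hne)
    set D := G - P.naturalGradient γ K with hD
    have h2 : P.metric γ K G D = P.metric γ K (D + P.naturalGradient γ K) D := by
      rw [hD, sub_add_cancel]
    rw [(hP.isRiemannianMetricOn γ).add_left K hK, ← h, hP.metric_naturalGradient γ hK] at h2
    linarith
  · rintro rfl
    exact ⟨differentiableAt_cost hK, fun V => (hP.metric_naturalGradient γ hK V).symm⟩

theorem Standard.contDiffAt_naturalGradient (hP : P.Standard) (γ : ℝ) {k : ℕ∞ω}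
    (hK : K ∈ P.stabilizing) : ContDiffAt ℝ k (P.naturalGradient γ) K :=
  ((contDiffAt_residual hK).matrix_mul (hP.contDiffAt_symPow_gramian hK (1 - γ))).const_smul
    (2 : ℝ)

/-- The derivative of the cost along the natural gradient flow. -/
theorem Standard.fderiv_cost_neg_naturalGradient (hP : P.Standard) (γ : ℝ)
    (hK : K ∈ P.stabilizing) :
    fderiv ℝ P.cost K (-P.naturalGradient γ K) =
      -(4 * ((P.residual K)ᵀ * P.residual K * symPow (P.gramian K) (2 - γ)).trace) := by
  have hY := hP.gramian_posDef hK
  rw [hP.fderiv_cost hK, naturalGradient]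
  nth_rewrite 2 [← symPow_one hY]
  rw [Matrix.mul_neg, Matrix.neg_mul, Matrix.trace_neg, Matrix.mul_smul, Matrix.smul_mul,
    Matrix.trace_smul, smul_eq_mul, ← Matrix.mul_assoc, Matrix.mul_assoc _ _ (symPow _ 1),
    symPow_mul_symPow hY, show (1 : ℝ) - γ + 1 = 2 - γ by ring]
  ring

end LQR

/-! ### Limits of Hurwitz matrices and compact sublevel sets -/

theorem Multiset.pow_card_le_norm_prod_map_sub {s : Multiset ℂ} {z : ℂ} (hz : 0 ≤ z.re)
    (h : ∀ x ∈ s, x.re < 0) : z.re ^ s.card ≤ ‖(s.map fun x => z - x).prod‖ := by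
  induction s using Multiset.induction_on with
  | empty => simp
  | cons a s ih =>
    rw [Multiset.card_cons, Multiset.map_cons, Multiset.prod_cons, norm_mul, pow_succ, mul_comm]
    refine mul_le_mul ?_ (ih fun x hx => h x (Multiset.mem_cons_of_mem hx))
      (pow_nonneg hz _) (norm_nonneg _)
    have h1 := h a (Multiset.mem_cons_self a s)
    refine le_trans ?_ (Complex.re_le_norm _)
    rw [Complex.sub_re]
    linarith

/-- Each root lies to the left of the imaginary axis, hence at distance at least `z.re` from `z`.
The bound does not depend on `A`, so it passes to limits and replaces continuity of eigenvalues. -/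
theorem IsHurwitz.pow_re_le_norm_eval_charpoly {A : Matrix (Fin n) (Fin n) ℝ} (hA : IsHurwitz A)
    {z : ℂ} (hz : 0 ≤ z.re) :
    z.re ^ n ≤ ‖(Matrix.scalar (Fin n) z - A.map Complex.ofReal).det‖ := by
  set p := (A.map Complex.ofReal).charpoly with hp
  have hs : p.Splits := IsAlgClosed.splits p
  have hm : p.Monic := Matrix.charpoly_monic _
  have hcard : p.roots.card = n := by
    rw [← hs.natDegree_eq_card_roots, hp, Matrix.charpoly_natDegree_eq_dim, Fintype.card_fin]
  have h1 : p.eval z = (p.roots.map fun x => z - x).prod := hs.eval_eq_prod_roots_of_monic hm z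
  rw [← Matrix.eval_charpoly, ← hp, h1]
  conv_lhs => rw [← hcard]
  refine Multiset.pow_card_le_norm_prod_map_sub hz fun x hx => hA x ?_
  rw [Matrix.mem_spectrum_iff_isRoot_charpoly]
  exact (Polynomial.mem_roots'.1 hx).2

theorem re_nonpos_of_tendsto_isHurwitz {ι : Type*} {l : Filter ι} [l.NeBot]
    {F : ι → Matrix (Fin n) (Fin n) ℝ} {A : Matrix (Fin n) (Fin n) ℝ}
    (hF : Tendsto F l (𝓝 A)) (hH : ∀ i, IsHurwitz (F i)) {z : ℂ}
    (hz : z ∈ spectrum ℂ (A.map Complex.ofReal)) : z.re ≤ 0 := by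
  by_contra! hpos
  have hcont : Continuous fun M : Matrix (Fin n) (Fin n) ℝ =>
      ‖(Matrix.scalar (Fin n) z - M.map Complex.ofReal).det‖ := by
    refine Continuous.norm (Continuous.matrix_det ?_)
    exact continuous_const.sub (continuous_id.matrix_map Complex.continuous_ofReal)
  have h1 := ge_of_tendsto ((hcont.tendsto A).comp hF)
    (Eventually.of_forall fun i => (hH i).pow_re_le_norm_eval_charpoly hpos.le)
  rw [Matrix.mem_spectrum_iff_isRoot_charpoly, Polynomial.IsRoot, Matrix.eval_charpoly] at hz
  rw [hz, norm_zero] at h1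
  exact absurd h1 (not_le.2 (pow_pos hpos n))

theorem Matrix.star_dotProduct_map_transpose_mulVec {k l : ℕ} (M : Matrix (Fin k) (Fin l) ℝ)
    (v : Fin l → ℂ) (u : Fin k → ℂ) :
    star v ⬝ᵥ (Mᵀ.map Complex.ofReal *ᵥ u) = star (M.map Complex.ofReal *ᵥ v) ⬝ᵥ u := by
  rw [Matrix.star_mulVec, ← Matrix.dotProduct_mulVec]
  congr 2
  ext i j
  simp

theorem Matrix.map_ofReal_mul_mulVec {k l r : ℕ} (M : Matrix (Fin k) (Fin l) ℝ)
    (N : Matrix (Fin l) (Fin r) ℝ) (v : Fin r → ℂ) :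
    (M * N).map Complex.ofReal *ᵥ v = M.map Complex.ofReal *ᵥ (N.map Complex.ofReal *ᵥ v) := by
  rw [Matrix.mulVec_mulVec]
  congr 1
  exact Matrix.map_mul (f := Complex.ofRealHom)

theorem Matrix.map_ofReal_add_mulVec {k l : ℕ} (M N : Matrix (Fin k) (Fin l) ℝ) (v : Fin l → ℂ) :
    (M + N).map Complex.ofReal *ᵥ v = M.map Complex.ofReal *ᵥ v + N.map Complex.ofReal *ᵥ v := by
  rw [← Matrix.add_mulVec]
  congr 1
  exact Matrix.map_add _ Complex.ofReal_add M N

namespace LQR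

variable {P : LQR n m} {K : Matrix (Fin m) (Fin n) ℝ}

open scoped ComplexOrder in
/-- If the Lyapunov equation of `K` is solvable, the closed-loop matrix has no eigenvalue on the
imaginary axis. -/
theorem Standard.re_ne_zero_of_lyapunov (hP : P.Standard) {X : Matrix (Fin n) (Fin n) ℝ}
    (hX : (P.closedLoop K)ᵀ * X + X * P.closedLoop K + Kᵀ * P.R * K + P.Q = 0) {z : ℂ}
    (hz : z ∈ spectrum ℂ ((P.closedLoop K).map Complex.ofReal)) : z.re ≠ 0 := by
  intro hz0
  obtain ⟨v, hv, hvz⟩ := (Matrix.mem_spectrum_iff_exists_mulVec _ _).1 hz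
  obtain ⟨C, hC⟩ := hP.posDef_R.posSemidef.exists_eq_transpose_mul_self
  obtain ⟨D, hD⟩ := hP.posSemidef_Q.exists_eq_transpose_mul_self
  set A := P.closedLoop K with hA
  set w := C.map Complex.ofReal *ᵥ (K.map Complex.ofReal *ᵥ v) with hw
  set w' := D.map Complex.ofReal *ᵥ v with hw'
  -- Pairing the equation with the eigenvector cancels the `X` terms, as they carry the factor `star
  -- z + z = 0`. What remains is a sum of two squares, so `C K v = 0` and `D v = 0`; hence `K v =
  -- 0`, and `v` is an eigenvector of `P.A` itself with `Q v = 0`, against observability.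
  have h1 : star v ⬝ᵥ ((Aᵀ * X + X * A + Kᵀ * P.R * K + P.Q).map Complex.ofReal *ᵥ v) = 0 := by
    rw [hX]
    simp [Matrix.map_zero]
  have h2 : (starRingEnd ℂ) z + z = 0 := by
    rw [add_comm, Complex.add_conj, hz0]; simp
  rw [hC, hD, Matrix.map_ofReal_add_mulVec, Matrix.map_ofReal_add_mulVec,
    Matrix.map_ofReal_add_mulVec, dotProduct_add, dotProduct_add, dotProduct_add] at h1
  simp only [Matrix.map_ofReal_mul_mulVec, Matrix.star_dotProduct_map_transpose_mulVec, hvz,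
    star_smul, smul_dotProduct, Matrix.mulVec_smul, dotProduct_smul, ← hw, ← hw'] at h1
  rw [← add_smul, show star z + z = 0 from h2, zero_smul, zero_add] at h1
  have h3 : (0 : ℂ) ≤ star w ⬝ᵥ w := dotProduct_star_self_nonneg w
  have h4 : (0 : ℂ) ≤ star w' ⬝ᵥ w' := dotProduct_star_self_nonneg w'
  have h5 := (add_eq_zero_iff_of_nonneg h3 h4).1 h1
  have hw0 : w = 0 := dotProduct_star_self_eq_zero.1 h5.1
  have hw0' : w' = 0 := dotProduct_star_self_eq_zero.1 h5.2
  have hKv : K.map Complex.ofReal *ᵥ v = 0 := by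
    have h6 : (P.R⁻¹ * P.R).map Complex.ofReal *ᵥ (K.map Complex.ofReal *ᵥ v) = 0 := by
      rw [Matrix.map_ofReal_mul_mulVec, hC, Matrix.map_ofReal_mul_mulVec, ← hw, hw0,
        Matrix.mulVec_zero, Matrix.mulVec_zero]
    rw [Matrix.nonsing_inv_mul _ ((Matrix.isUnit_iff_isUnit_det _).1 hP.posDef_R.isUnit)] at h6
    rwa [Matrix.map_one _ Complex.ofReal_zero Complex.ofReal_one, Matrix.one_mulVec] at h6
  refine hP.observable z v hz0 hv ?_ ?_
  · have h7 : P.A = A + P.B * K := by rw [hA, closedLoop, sub_add_cancel]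
    rw [h7, Matrix.map_ofReal_add_mulVec, Matrix.map_ofReal_mul_mulVec, hKv, Matrix.mulVec_zero,
      add_zero, hvz]
  · rw [hD, Matrix.map_ofReal_mul_mulVec, ← hw', hw0', Matrix.mulVec_zero]

/-- The stabilizing gains of cost at most `a`. -/
def sublevel (P : LQR n m) (a : ℝ) : Set (Matrix (Fin m) (Fin n) ℝ) :=
  {K | K ∈ P.stabilizing ∧ P.cost K ≤ a}

/-- The cost dominates `ρ Tr(Kᵀ K Y_K)`, and the lower bound of `Y_K` decays at most like `1 / ‖K‖`,
so the cost grows at least linearly in `‖K‖`. -/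
theorem Standard.exists_norm_le_of_mem_sublevel (hP : P.Standard) (a : ℝ) :
    ∃ C, ∀ K ∈ P.sublevel a, ‖K‖ ≤ C := by
  obtain ⟨σ, hσ, hS⟩ := hP.initCov_posDef.exists_sub_smul_one_posSemidef
  obtain ⟨ρ, hρ, hR⟩ := hP.posDef_R.exists_trace_conj_le (n := n)
  set α := ‖P.A‖
  set β := ‖P.B‖
  have hα : 0 ≤ α := norm_nonneg _
  have hβ : 0 ≤ β := norm_nonneg _
  refine ⟨max 1 (|a| * (2 * α + 2 * β + 1) / (ρ * σ)), fun K hK => ?_⟩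
  rcases le_total ‖K‖ 1 with h | hk
  · exact h.trans (le_max_left _ _)
  refine le_trans ?_ (le_max_right _ _)
  set k := ‖K‖
  have hD : 0 < 2 * α + 2 * β * k + 1 := by positivity
  -- The denominator exceeds twice the bound `α + β * k` of the closed-loop norm, as the Gramian
  -- bound requires. Since `1 ≤ k`, it is later absorbed into a multiple of `k`.
  set ε := σ / (2 * α + 2 * β * k + 1) with hε
  have hε0 : 0 < ε := by positivity
  have hAK : ‖P.closedLoop K‖ ≤ α + β * k :=
    (norm_sub_le _ _).trans (add_le_add le_rfl (Matrix.frobenius_norm_mul _ _))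
  have hY := gramian_sub_smul_one_posSemidef hK.1 hS hε0.le (by
    have h1 : ε * (2 * α + 2 * β * k + 1) = σ := div_mul_cancel₀ _ hD.ne'
    nlinarith [mul_le_mul_of_nonneg_left hAK hε0.le])
  have hYpos := hP.gramian_posDef hK.1
  have h1 : 0 ≤ (Kᵀ * K * (P.gramian K - ε • 1)).trace := by
    refine Matrix.PosSemidef.trace_mul_nonneg ?_ hY
    simpa using Matrix.PosSemidef.one.conj_transpose K
  rw [Matrix.mul_sub, Matrix.trace_sub, Matrix.mul_smul, Matrix.trace_smul, Matrix.mul_one,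
    ← Matrix.frobenius_norm_sq, smul_eq_mul] at h1
  have h2 := hR K hYpos.posSemidef
  have h3 := hP.posSemidef_Q.trace_mul_nonneg hYpos.posSemidef
  have h4 := hK.2
  rw [cost_eq_trace_gramian hK.1, Matrix.add_mul, Matrix.trace_add] at h4
  have h5 : ρ * (ε * k ^ 2) ≤ a := by
    have := mul_le_mul_of_nonneg_left (sub_nonneg.1 h1) hρ.le
    linarith
  have h6 : ρ * σ * k ^ 2 ≤ |a| * ((2 * α + 2 * β + 1) * k) := by
    calc ρ * σ * k ^ 2 = ρ * (ε * k ^ 2) * (2 * α + 2 * β * k + 1) := by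
          rw [hε]; field_simp
      _ ≤ |a| * (2 * α + 2 * β * k + 1) :=
          mul_le_mul_of_nonneg_right (h5.trans (le_abs_self a)) hD.le
      _ ≤ |a| * ((2 * α + 2 * β + 1) * k) :=
          mul_le_mul_of_nonneg_left (by nlinarith) (abs_nonneg a)
  rw [le_div_iff₀ (by positivity)]
  refine le_of_mul_le_mul_right ?_ (lt_of_lt_of_le one_pos hk)
  calc k * (ρ * σ) * k = ρ * σ * k ^ 2 := by ring
    _ ≤ |a| * ((2 * α + 2 * β + 1) * k) := h6
    _ = |a| * (2 * α + 2 * β + 1) * k := by ring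

/-- `σ‖X_K‖ ≤ σ Tr X_K ≤ Tr(X_K Σ) = f(K)`. It supplies limit points of `X_K` even when the gains
might approach the boundary of the stabilizing set. -/
theorem Standard.exists_norm_valueMatrix_le_of_mem_sublevel (hP : P.Standard) (a : ℝ) :
    ∃ C, ∀ K ∈ P.sublevel a, ‖P.valueMatrix K‖ ≤ C := by
  obtain ⟨σ, hσ, hS⟩ := hP.initCov_posDef.exists_sub_smul_one_posSemidef
  refine ⟨a / σ, fun K hK => ?_⟩
  have hX := hP.valueMatrix_posSemidef hK.1
  refine hX.norm_le_trace.trans ?_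
  have h1 := hX.trace_mul_nonneg hS
  rw [Matrix.mul_sub, Matrix.trace_sub, ← cost_eq_trace hK.1, Matrix.mul_smul, Matrix.trace_smul,
    Matrix.mul_one, smul_eq_mul] at h1
  rw [le_div_iff₀ hσ]
  have := hK.2
  linarith

theorem Standard.isCompact_sublevel (hP : P.Standard) (a : ℝ) : IsCompact (P.sublevel a) := by
  have : ProperSpace (Matrix (Fin m) (Fin n) ℝ) := FiniteDimensional.proper_real _
  have : ProperSpace (Matrix (Fin n) (Fin n) ℝ) := FiniteDimensional.proper_real _
  refine IsSeqCompact.isCompact fun u hu => ?_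
  obtain ⟨C₁, h₁⟩ := hP.exists_norm_le_of_mem_sublevel a
  obtain ⟨C₂, h₂⟩ := hP.exists_norm_valueMatrix_le_of_mem_sublevel a
  have hb : ∀ i, (u i, P.valueMatrix (u i)) ∈
      Metric.closedBall (0 : Matrix (Fin m) (Fin n) ℝ) C₁ ×ˢ
        Metric.closedBall (0 : Matrix (Fin n) (Fin n) ℝ) C₂ := fun i =>
    ⟨by simpa using h₁ _ (hu i), by simpa using h₂ _ (hu i)⟩
  obtain ⟨⟨K, X⟩, -, φ, hφ, hlim⟩ :=
    ((isCompact_closedBall _ _).prod (isCompact_closedBall _ _)).tendsto_subseq hb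
  have hKlim : Tendsto (fun i => u (φ i)) atTop (𝓝 K) := (continuous_fst.tendsto _).comp hlim
  have hlyap : (P.closedLoop K)ᵀ * X + X * P.closedLoop K + Kᵀ * P.R * K + P.Q = 0 := by
    have hcl : Continuous P.closedLoop := (contDiff_closedLoop (k := 0)).continuous
    have hcont : Continuous fun p : Matrix (Fin m) (Fin n) ℝ × Matrix (Fin n) (Fin n) ℝ =>
        (P.closedLoop p.1)ᵀ * p.2 + p.2 * P.closedLoop p.1 + p.1ᵀ * P.R * p.1 + P.Q := by
      have h1 := hcl.comp (continuous_fst (X := Matrix (Fin m) (Fin n) ℝ)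
        (Y := Matrix (Fin n) (Fin n) ℝ))
      exact (((h1.matrix_transpose.matrix_mul continuous_snd).add
        (continuous_snd.matrix_mul h1)).add ((continuous_fst.matrix_transpose.matrix_mul
          continuous_const).matrix_mul continuous_fst)).add continuous_const
    refine tendsto_nhds_unique ((hcont.tendsto (K, X)).comp hlim)
      (tendsto_const_nhds.congr fun i => ?_)
    exact ((valueMatrix_iff (hu (φ i)).1 _).2 rfl).symm
  -- Passing to the limit leaves eigenvalues in the closed left half plane; the limiting Lyapunov
  -- equation removes the imaginary axis.
  have hK : K ∈ P.stabilizing := by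
    intro z hz
    refine lt_of_le_of_ne ?_ (hP.re_ne_zero_of_lyapunov hlyap hz)
    exact re_nonpos_of_tendsto_isHurwitz
      (((contDiff_closedLoop (P := P) (k := 0)).continuous.tendsto K).comp hKlim)
      (fun i => (hu (φ i)).1) hz
  refine ⟨K, ⟨hK, ?_⟩, φ, hφ, hKlim⟩
  exact le_of_tendsto
    ((contDiffAt_cost (k := 0) hK).continuousAt.tendsto.comp hKlim)
    (Eventually.of_forall fun i => (hu (φ i)).2)

end LQR

/-! ### Global solutions of ordinary differential equations -/

section ode

variable {E : Type*} [NormedAddCommGroup E] [NormedSpace ℝ E]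

/-- A `C¹` vector field on an open set can be cut off, without change on a given compact set, to a
bounded Lipschitz vector field that is a nonnegative multiple of the original one. -/
theorem exists_lipschitzWith_cutoff [FiniteDimensional ℝ E] {U S : Set E} (hU : IsOpen U)
    (hS : IsCompact S) (hSU : S ⊆ U) {F : E → E} (hF : ∀ x ∈ U, ContDiffAt ℝ 1 F x) :
    ∃ (G : E → E) (L M : NNReal), LipschitzWith L G ∧ (∀ x, ‖G x‖ ≤ M) ∧ EqOn G F S ∧
      ∀ x, ∃ c : ℝ, 0 ≤ c ∧ G x = c • F x := by
  have : ProperSpace E := FiniteDimensional.proper_real E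
  obtain ⟨C, hC, hSC, hCU⟩ := exists_compact_between hS hU hSU
  obtain ⟨χ, hχ, hrange, h0, h1⟩ := exists_contMDiff_zero_iff_one_iff_of_isClosed (n := ⊤)
    (modelWithCornersSelf ℝ E) (isOpen_interior (s := C)).isClosed_compl hS.isClosed
    (disjoint_left.2 fun x hx hxS => hx (hSC hxS))
  have hχ' : ContDiff ℝ 1 χ := (contMDiff_iff_contDiff.1 hχ).of_le (by exact_mod_cast le_top)
  have hsupp : Function.support χ ⊆ C := fun x hx => by
    by_contra hxC
    exact hx ((h0 x).1 fun h => hxC (interior_subset h))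
  have htsupp : tsupport χ ⊆ C := closure_minimal hsupp hC.isClosed
  have hsmooth : ContDiff ℝ 1 fun x => χ x • F x := by
    refine contDiff_iff_contDiffAt.2 fun x => ?_
    by_cases hx : x ∈ U
    · exact hχ'.contDiffAt.smul (hF x hx)
    · have hx' : x ∉ tsupport χ := fun h => hx (hCU (htsupp h))
      refine contDiffAt_const (c := (0 : E)) |>.congr_of_eventuallyEq ?_
      filter_upwards [notMem_tsupport_iff_eventuallyEq.1 hx'] with y hy
      rw [hy]; simp
  have hcs : HasCompactSupport fun x => χ x • F x :=
    HasCompactSupport.smul_right (HasCompactSupport.of_support_subset_isCompact hC hsupp)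
  obtain ⟨L, hL⟩ := hsmooth.lipschitzWith_of_hasCompactSupport hcs one_ne_zero
  obtain ⟨M, hM⟩ := hcs.exists_bound_of_continuous hsmooth.continuous
  refine ⟨_, L, M.toNNReal, hL, fun x => (hM x).trans (Real.le_coe_toNNReal M), fun x hx => ?_,
    fun x => ⟨χ x, (hrange ⟨x, rfl⟩).1, rfl⟩⟩
  simp only [(h1 x).1 hx, one_smul]

/-- Two solutions on `[0, T]` of an autonomous Lipschitz equation agree if their initial values
do. -/
theorem LipschitzWith.eqOn_Icc_of_hasDerivWithinAt {G : E → E} {L : NNReal}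
    (hG : LipschitzWith L G) {T : ℝ} {α β : ℝ → E}
    (hα : ∀ t ∈ Icc 0 T, HasDerivWithinAt α (G (α t)) (Icc 0 T) t)
    (hβ : ∀ t ∈ Icc 0 T, HasDerivWithinAt β (G (β t)) (Icc 0 T) t) (h : α 0 = β 0) :
    EqOn α β (Icc 0 T) := by
  have key : ∀ {α : ℝ → E}, (∀ t ∈ Icc 0 T, HasDerivWithinAt α (G (α t)) (Icc 0 T) t) →
      ∀ t ∈ Ico 0 T, HasDerivWithinAt α (G (α t)) (Ici t) t := fun hα t ht =>
    (hα t ⟨ht.1, ht.2.le⟩).mono_of_mem_nhdsWithin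
      (mem_of_superset (Icc_mem_nhdsGE ht.2) (Icc_subset_Icc_left ht.1))
  exact ODE_solution_unique_of_mem_Icc_right (v := fun _ => G) (s := fun _ => univ)
    (fun _ _ => hG.lipschitzOnWith) (fun t ht => (hα t ht).continuousWithinAt) (key hα)
    (fun _ _ => trivial) (fun t ht => (hβ t ht).continuousWithinAt) (key hβ)
    (fun _ _ => trivial) h

/-- For a field bounded by `M`, a ball of radius `M * (N + 1)` lets Picard–Lindelöf reach all of
`[0, N + 1]`; uniqueness glues these solutions. -/
theorem LipschitzWith.exists_hasDerivWithinAt_Ici [CompleteSpace E] {G : E → E} {L M : NNReal}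
    (hG : LipschitzWith L G) (hM : ∀ x, ‖G x‖ ≤ M) (x₀ : E) :
    ∃ α : ℝ → E, α 0 = x₀ ∧ ∀ t, 0 ≤ t → HasDerivWithinAt α (G (α t)) (Ici 0) t := by
  have hex : ∀ N : ℕ, ∃ α : ℝ → E, α 0 = x₀ ∧ ∀ t ∈ Icc (0 : ℝ) (N + 1),
      HasDerivWithinAt α (G (α t)) (Icc (0 : ℝ) (N + 1)) t := by
    intro N
    have hPL : IsPicardLindelof (fun _ : ℝ => G) (tmin := 0) (tmax := N + 1)
        ⟨0, ⟨le_rfl, by positivity⟩⟩ x₀ (M * (N + 1)) 0 M L :=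
      { lipschitzOnWith := fun _ _ => hG.lipschitzOnWith
        continuousOn := fun _ _ => continuousOn_const
        norm_le := fun _ _ x _ => hM x
        mul_max_le := by
          have h1 : (0 : ℝ) ≤ N + 1 := by positivity
          simp [max_eq_left h1] }
    exact hPL.exists_eq_forall_mem_Icc_hasDerivWithinAt (Metric.mem_closedBall_self (by simp))
  choose α hα0 hα using hex
  have hagree : ∀ {N N' : ℕ}, N ≤ N' → EqOn (α N) (α N') (Icc (0 : ℝ) (N + 1)) := by
    intro N N' h
    have hsub : Icc (0 : ℝ) (N + 1) ⊆ Icc (0 : ℝ) (N' + 1) := by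
      refine Icc_subset_Icc_right ?_
      have : (N : ℝ) ≤ N' := by exact_mod_cast h
      linarith
    exact hG.eqOn_Icc_of_hasDerivWithinAt (hα N)
      (fun t ht => (hα N' t (hsub ht)).mono hsub) ((hα0 N).trans (hα0 N').symm)
  have hmem : ∀ {t : ℝ}, 0 ≤ t → t ∈ Icc (0 : ℝ) (⌊t⌋₊ + 1) := fun ht =>
    ⟨ht, (Nat.lt_floor_add_one _).le⟩
  -- The solution with index `⌊t⌋₊` lives on `[0, ⌊t⌋₊ + 1]`, so `t` is never its right endpoint and
  -- the derivative within the interval is one within `Ici 0`.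
  refine ⟨fun t => α ⌊t⌋₊ t, by simpa using hα0 0, fun t ht => ?_⟩
  have hnhds : Icc (0 : ℝ) (⌊t⌋₊ + 1) ∈ 𝓝[Ici 0] t := by
    rw [← Ici_inter_Iic]
    exact inter_mem self_mem_nhdsWithin
      (mem_nhdsWithin_of_mem_nhds (Iic_mem_nhds (Nat.lt_floor_add_one t)))
  refine ((hα ⌊t⌋₊ t (hmem ht)).mono_of_mem_nhdsWithin hnhds).congr_of_eventuallyEq_of_mem ?_ ht
  have hlt : ∀ᶠ s : ℝ in 𝓝[Ici 0] t, s < (⌊t⌋₊ : ℝ) + 1 :=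
    eventually_nhdsWithin_of_eventually_nhds (eventually_lt_nhds (Nat.lt_floor_add_one t))
  filter_upwards [hlt, self_mem_nhdsWithin] with s hs hs0
  refine hagree ?_ (hmem hs0)
  rw [← Nat.lt_add_one_iff]
  exact (Nat.floor_lt hs0).2 (by exact_mod_cast hs)

end ode

/-! ### Uniform bounds for weighted trace forms on compact sets -/

section compact

variable {F : Type*} [TopologicalSpace F] {S : Set F} {W : F → Matrix (Fin n) (Fin n) ℝ}

theorem contDiff_trace_conj (R : Matrix (Fin m) (Fin m) ℝ) {k : ℕ∞ω} :
    ContDiff ℝ k fun z : Matrix (Fin m) (Fin n) ℝ × Matrix (Fin n) (Fin n) ℝ =>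
      (z.1ᵀ * R * z.1 * z.2).trace :=
  contDiff_iff_contDiffAt.2 fun _ => (((contDiffAt_fst.matrix_transpose.matrix_mul
    contDiffAt_const).matrix_mul contDiffAt_fst).matrix_mul contDiffAt_snd).matrix_trace

theorem ContinuousOn.trace_conj (hW : ContinuousOn W S) (R : Matrix (Fin m) (Fin m) ℝ) :
    ContinuousOn (Function.uncurry fun p (M : Matrix (Fin m) (Fin n) ℝ) =>
      (Mᵀ * R * M * W p).trace) (S ×ˢ univ) := by
  have h1 : ContinuousOn (fun z : F × Matrix (Fin m) (Fin n) ℝ => (z.2, W z.1)) (S ×ˢ univ) :=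
    continuousOn_snd.prodMk (hW.comp continuousOn_fst fun z hz => hz.1)
  have h2 := Continuous.comp_continuousOn
    (g := fun z : Matrix (Fin m) (Fin n) ℝ × Matrix (Fin n) (Fin n) ℝ =>
      (z.1ᵀ * R * z.1 * z.2).trace)
    (f := fun z : F × Matrix (Fin m) (Fin n) ℝ => (z.2, W z.1))
    (contDiff_trace_conj R (k := 0)).continuous h1
  exact h2

theorem Matrix.trace_conj_smul (R : Matrix (Fin m) (Fin m) ℝ) (Y : Matrix (Fin n) (Fin n) ℝ)
    (a : ℝ) (M : Matrix (Fin m) (Fin n) ℝ) :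
    ((a • M)ᵀ * R * (a • M) * Y).trace = a ^ 2 * (Mᵀ * R * M * Y).trace := by
  simp only [Matrix.transpose_smul, Matrix.smul_mul, Matrix.mul_smul, Matrix.trace_smul,
    smul_eq_mul]
  ring

theorem exists_trace_conj_le_mul_norm_sq (hS : IsCompact S) (hW : ContinuousOn W S)
    (R : Matrix (Fin m) (Fin m) ℝ) : ∃ C > 0, ∀ p ∈ S, ∀ M : Matrix (Fin m) (Fin n) ℝ,
      (Mᵀ * R * M * W p).trace ≤ C * ‖M‖ ^ 2 :=
  exists_forall_le_mul_norm_sq hS (hW.trace_conj R) fun p _ => Matrix.trace_conj_smul R (W p)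

theorem exists_mul_norm_sq_le_trace_conj (hS : IsCompact S) (hW : ContinuousOn W S)
    (hpos : ∀ p ∈ S, (W p).PosDef) {R : Matrix (Fin m) (Fin m) ℝ} (hR : R.PosDef) :
    ∃ c > 0, ∀ p ∈ S, ∀ M : Matrix (Fin m) (Fin n) ℝ,
      c * ‖M‖ ^ 2 ≤ (Mᵀ * R * M * W p).trace := by
  refine exists_forall_mul_norm_sq_le hS (hW.trace_conj R)
    (fun p _ => Matrix.trace_conj_smul R (W p)) fun p hp M hM => ?_
  obtain ⟨ρ, hρ, h⟩ := hR.exists_trace_conj_le (n := n)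
  exact (mul_pos hρ ((hpos p hp).trace_pos_of_ne_zero hM)).trans_le (h M (hpos p hp).posSemidef)

end compact

/-! ### Optimal gain, gradient dominance and the flow -/

namespace LQR

variable {P : LQR n m} {K : Matrix (Fin m) (Fin n) ℝ}

theorem continuousOn_cost (P : LQR n m) : ContinuousOn P.cost P.stabilizing := fun _ hK =>
  (contDiffAt_cost (k := 0) hK).continuousAt.continuousWithinAt

theorem Standard.exists_isOptimal (hP : P.Standard) : ∃ K, P.IsOptimal K := by
  obtain ⟨K₁, hK₁⟩ := hP.stabilizable
  obtain ⟨K, hK, hmin⟩ := (hP.isCompact_sublevel (P.cost K₁)).exists_isMinOn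
    ⟨K₁, hK₁, le_rfl⟩ (P.continuousOn_cost.mono fun _ h => h.1)
  refine ⟨K, hK.1, fun L hL => ?_⟩
  rcases le_total (P.cost L) (P.cost K₁) with h | h
  · exact hmin ⟨hL, h⟩
  · exact hK.2.trans h

/-- The vanishing differential is tested on the residual itself, which gives `Tr(Nᵀ N Y) = 0` with
`Y` positive definite. -/
theorem Standard.residual_eq_zero_of_isOptimal (hP : P.Standard) (hK : P.IsOptimal K) :
    P.residual K = 0 := by
  have hmin : IsLocalMin P.cost K := by
    filter_upwards [P.isOpen_stabilizing.mem_nhds hK.1] with L hL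
    exact hK.2 L hL
  have h1 := hP.fderiv_cost hK.1 (P.residual K)
  rw [hmin.fderiv_eq_zero] at h1
  by_contra hne
  have h2 := (hP.gramian_posDef hK.1).trace_pos_of_ne_zero hne
  simp only [zero_apply] at h1
  linarith

theorem Standard.cost_sub_cost_of_isOptimal (hP : P.Standard) (hK : P.IsOptimal K)
    {L : Matrix (Fin m) (Fin n) ℝ} (hL : L ∈ P.stabilizing) :
    P.cost L - P.cost K = ((L - K)ᵀ * P.R * (L - K) * P.gramian L).trace := by
  rw [hP.cost_sub_cost hK.1 hL, hP.residual_eq_zero_of_isOptimal hK]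
  simp

theorem Standard.isOptimal_unique (hP : P.Standard) (hK : P.IsOptimal K)
    {L : Matrix (Fin m) (Fin n) ℝ} (hL : P.IsOptimal L) : L = K := by
  by_contra hne
  have h1 := hP.cost_sub_cost_of_isOptimal hK hL.1
  obtain ⟨ρ, hρ, hR⟩ := hP.posDef_R.exists_trace_conj_le (n := n)
  have hY := hP.gramian_posDef hL.1
  have h2 := hR (L - K) hY.posSemidef
  have h3 := mul_pos hρ (hY.trace_pos_of_ne_zero (sub_ne_zero.2 hne))
  have h4 := hL.2 K hK.1
  linarith

/-- Gradient dominance: the suboptimality is at most a multiple of the squared residual. -/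
theorem Standard.exists_cost_sub_le_norm_residual_sq (hP : P.Standard)
    {Kopt : Matrix (Fin m) (Fin n) ℝ} (hopt : P.IsOptimal Kopt) :
    ∃ C > 0, ∀ K ∈ P.stabilizing, P.cost K - P.cost Kopt ≤ C * ‖P.residual K‖ ^ 2 := by
  obtain ⟨ρ, hρ, hR⟩ := hP.posDef_R.exists_trace_conj_le (n := n)
  set Y := P.gramian Kopt
  have hY : Y.PosDef := hP.gramian_posDef hopt.1
  obtain ⟨C₀, hC₀0, hC₀⟩ := exists_trace_conj_le_mul_norm_sq (S := (univ : Set Unit))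
    isCompact_univ (W := fun _ => Y) continuousOn_const (1 : Matrix (Fin m) (Fin m) ℝ)
  refine ⟨ρ⁻¹ * C₀, by positivity, fun K hK => ?_⟩
  set N := P.residual K
  set D := Kopt - K
  -- The identity is based at `K` and ends at `Kopt`, so the weight is the fixed Gramian of `Kopt`
  -- and the constant is uniform in `K`.
  have h1 : P.cost Kopt - P.cost K = ((Dᵀ * P.R * D + Dᵀ * N + Nᵀ * D) * Y).trace :=
    hP.cost_sub_cost hK hopt.1
  have h2 := hR D hY.posSemidef
  -- Completing the square: `ρ DᵀD + DᵀN + NᵀD` is at least `-ρ⁻¹ NᵀN`.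
  have h3 : 0 ≤ ((ρ • D + N)ᵀ * (ρ • D + N) * Y).trace := by
    refine Matrix.PosSemidef.trace_mul_nonneg ?_ hY.posSemidef
    simpa using Matrix.PosSemidef.one.conj_transpose (ρ • D + N)
  have h4 : (Nᵀ * N * Y).trace ≤ C₀ * ‖N‖ ^ 2 := by
    simpa using hC₀ () trivial N
  simp only [Matrix.transpose_add, Matrix.transpose_smul, Matrix.add_mul, Matrix.mul_add,
    Matrix.smul_mul, Matrix.mul_smul, Matrix.trace_add, Matrix.trace_smul, smul_eq_mul] at h1 h3
  rw [mul_assoc, ← mul_le_mul_iff_right₀ hρ, mul_inv_cancel_left₀ hρ.ne']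
  nlinarith

theorem Standard.fderiv_cost_neg_naturalGradient_nonpos (hP : P.Standard) (γ : ℝ)
    (hK : K ∈ P.stabilizing) : fderiv ℝ P.cost K (-P.naturalGradient γ K) ≤ 0 := by
  have h1 : ((P.residual K)ᵀ * P.residual K).PosSemidef := by
    simpa using Matrix.PosSemidef.one.conj_transpose (P.residual K)
  have h2 := h1.trace_mul_nonneg (symPow_posDef (hP.gramian_posDef hK) (2 - γ)).posSemidef
  rw [hP.fderiv_cost_neg_naturalGradient γ hK]
  linarith

namespace IsNaturalGradientFlow

variable {γ : ℝ} {K₀ : Matrix (Fin m) (Fin n) ℝ} {α : ℝ → Matrix (Fin m) (Fin n) ℝ}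

theorem hasDerivWithinAt (h : P.IsNaturalGradientFlow γ K₀ α) {t : ℝ} (ht : 0 ≤ t) :
    HasDerivWithinAt α (-P.naturalGradient γ (α t)) (Ici 0) t :=
  h.deriv t ht

theorem hasDerivWithinAt_cost (hP : P.Standard) (h : P.IsNaturalGradientFlow γ K₀ α) {t : ℝ}
    (ht : 0 ≤ t) : HasDerivWithinAt (fun t => P.cost (α t))
      (-(4 * ((P.residual (α t))ᵀ * P.residual (α t)
        * symPow (P.gramian (α t)) (2 - γ)).trace)) (Ici 0) t := by
  rw [← hP.fderiv_cost_neg_naturalGradient γ (h.mem t ht)]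
  exact (differentiableAt_cost (h.mem t ht)).hasFDerivAt.comp_hasDerivWithinAt t
    (h.hasDerivWithinAt ht)

theorem antitoneOn_cost (hP : P.Standard) (h : P.IsNaturalGradientFlow γ K₀ α) :
    AntitoneOn (fun t => P.cost (α t)) (Ici 0) := by
  refine antitoneOn_of_hasDerivWithinAt_nonpos (convex_Ici 0)
    (fun t ht => (h.hasDerivWithinAt_cost hP ht).continuousWithinAt)
    (fun t ht => (h.hasDerivWithinAt_cost hP (interior_subset ht)).mono interior_subset)
    fun t ht => ?_
  rw [← hP.fderiv_cost_neg_naturalGradient γ (h.mem t (interior_subset ht))]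
  exact hP.fderiv_cost_neg_naturalGradient_nonpos γ (h.mem t (interior_subset ht))

theorem mem_sublevel (hP : P.Standard) (h : P.IsNaturalGradientFlow γ K₀ α) {a : ℝ}
    (ha : P.cost K₀ ≤ a) {t : ℝ} (ht : 0 ≤ t) : α t ∈ P.sublevel a := by
  refine ⟨h.mem t ht, le_trans ?_ ha⟩
  have := h.antitoneOn_cost hP (mem_Ici.2 le_rfl) (mem_Ici.2 ht) ht
  simpa only [h.init] using this

end IsNaturalGradientFlow

/-- Sublevel sets of the cost are invariant under any field that points along the negative natural
gradient. -/
theorem Standard.mem_sublevel_of_hasDerivWithinAt (hP : P.Standard) {γ a : ℝ}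
    {G : Matrix (Fin m) (Fin n) ℝ → Matrix (Fin m) (Fin n) ℝ}
    (hG : ∀ K, ∃ c : ℝ, 0 ≤ c ∧ G K = c • -P.naturalGradient γ K)
    {α : ℝ → Matrix (Fin m) (Fin n) ℝ} (h0 : α 0 ∈ P.sublevel a)
    (hα : ∀ t, 0 ≤ t → HasDerivWithinAt α (G (α t)) (Ici 0) t) {t : ℝ} (ht : 0 ≤ t) :
    α t ∈ P.sublevel a := by
  have hcont : ContinuousOn α (Ici 0) := fun s hs => (hα s hs).continuousWithinAt
  have hclosed : IsClosed ({s | α s ∈ P.sublevel a} ∩ Icc 0 t) := by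
    rw [inter_comm]
    exact (hcont.mono Icc_subset_Ici_self).preimage_isClosed_of_isClosed isClosed_Icc
      (hP.isCompact_sublevel a).isClosed
  -- Continuous induction in time: the good times are closed since the sublevel set is, and from a
  -- good time the curve stays stabilizing for a while by openness, with nonincreasing cost.
  refine hclosed.Icc_subset_of_forall_mem_nhdsWithin h0 (fun x hx => ?_) (right_mem_Icc.2 ht)
  have hx0 : 0 ≤ x := hx.2.1
  have hev : ∀ᶠ s in 𝓝[≥] x, α s ∈ P.stabilizing :=
    ((hcont x hx0).mono (Ici_subset_Ici.2 hx0)).eventually_mem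
      (P.isOpen_stabilizing.mem_nhds hx.1.1)
  obtain ⟨y, hxy, hy⟩ := mem_nhdsGE_iff_exists_Ico_subset.1 hev
  have hd : ∀ s ∈ Ico x y, HasDerivWithinAt (fun s => P.cost (α s))
      (fderiv ℝ P.cost (α s) (G (α s))) (Ico x y) s := fun s hs =>
    (differentiableAt_cost (hy hs)).hasFDerivAt.comp_hasDerivWithinAt s
      ((hα s (hx0.trans hs.1)).mono fun r hr => hx0.trans hr.1)
  have hanti : AntitoneOn (fun s => P.cost (α s)) (Ico x y) := by
    refine antitoneOn_of_hasDerivWithinAt_nonpos (convex_Ico x y)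
      (fun s hs => (hd s hs).continuousWithinAt)
      (fun s hs => (hd s (interior_subset hs)).mono interior_subset) fun s hs => ?_
    obtain ⟨c, hc, hGc⟩ := hG (α s)
    rw [hGc, map_smul, smul_eq_mul]
    exact mul_nonpos_of_nonneg_of_nonpos hc
      (hP.fderiv_cost_neg_naturalGradient_nonpos γ (hy (interior_subset hs)))
  filter_upwards [Ioo_mem_nhdsGT hxy] with s hs
  exact ⟨hy ⟨hs.1.le, hs.2⟩,
    (hanti (left_mem_Ico.2 hxy) ⟨hs.1.le, hs.2⟩ hs.1.le).trans hx.1.2⟩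

/-- The field is cut off away from the sublevel set of `K₀`. The global solution of the cut-off
equation never leaves that set, where both fields agree; any solution of the flow stays there as
well, so uniqueness for the Lipschitz field applies. -/
theorem Standard.exists_unique_flow (hP : P.Standard) (γ : ℝ)
    {K₀ : Matrix (Fin m) (Fin n) ℝ} (hK₀ : K₀ ∈ P.stabilizing) :
    ∃ α : ℝ → Matrix (Fin m) (Fin n) ℝ, P.IsNaturalGradientFlow γ K₀ α ∧
      ∀ β : ℝ → Matrix (Fin m) (Fin n) ℝ, P.IsNaturalGradientFlow γ K₀ β →
        EqOn β α (Ici 0) := by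
  obtain ⟨G, L, M, hL, hM, hGF, hGc⟩ := exists_lipschitzWith_cutoff P.isOpen_stabilizing
    (hP.isCompact_sublevel (P.cost K₀)) (fun K hK => hK.1)
    (F := fun K => -P.naturalGradient γ K)
    (fun K hK => (hP.contDiffAt_naturalGradient γ hK).neg)
  obtain ⟨α, hα0, hα⟩ := hL.exists_hasDerivWithinAt_Ici hM K₀
  have hmem : ∀ t, 0 ≤ t → α t ∈ P.sublevel (P.cost K₀) := fun t ht =>
    hP.mem_sublevel_of_hasDerivWithinAt hGc (by rw [hα0]; exact ⟨hK₀, le_rfl⟩) hα ht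
  refine ⟨α, ⟨hα0, fun t ht => (hmem t ht).1, fun t ht => ?_⟩, fun β hβ t ht => ?_⟩
  · have h1 := hα t ht
    rw [hGF (hmem t ht)] at h1
    exact h1
  · refine hL.eqOn_Icc_of_hasDerivWithinAt (T := t) (fun s hs => ?_)
      (fun s hs => (hα s hs.1).mono Icc_subset_Ici_self) (hβ.init.trans hα0.symm)
      (right_mem_Icc.2 ht)
    rw [hGF (hβ.mem_sublevel hP le_rfl hs.1)]
    exact (hβ.hasDerivWithinAt hs.1).mono Icc_subset_Ici_self

theorem Standard.exists_exponential_decay (hP : P.Standard) (γ : ℝ)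
    {Kopt : Matrix (Fin m) (Fin n) ℝ} (hopt : P.IsOptimal Kopt) (a : ℝ) :
    ∃ r > 0, ∀ K₀ : Matrix (Fin m) (Fin n) ℝ, P.cost K₀ ≤ a →
      ∀ α, P.IsNaturalGradientFlow γ K₀ α → ∀ t, 0 ≤ t →
        P.cost (α t) - P.cost Kopt ≤ Real.exp (-r * t) * (P.cost K₀ - P.cost Kopt) := by
  obtain ⟨c, hc, hcle⟩ := exists_mul_norm_sq_le_trace_conj (m := m) (hP.isCompact_sublevel a)
    (W := fun K => symPow (P.gramian K) (2 - γ))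
    (fun K hK => (hP.contDiffAt_symPow_gramian (k := 0) hK.1
      (2 - γ)).continuousAt.continuousWithinAt)
    (fun K hK => symPow_posDef (hP.gramian_posDef hK.1) _) Matrix.PosDef.one
  obtain ⟨C, hC, hCle⟩ := hP.exists_cost_sub_le_norm_residual_sq hopt
  -- The cost falls at rate at least `4 c ‖N‖ ^ 2`, and dominance gives `‖N‖ ^ 2 ≥ (f - f*) / C`.
  -- The constant `c` depends on `a` through the compact sublevel set.
  refine ⟨4 * c / C, by positivity, fun K₀ hK₀ α hα t ht => ?_⟩
  set r := 4 * c / C with hr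
  let ψ : ℝ → ℝ := fun t => Real.exp (r * t) * (P.cost (α t) - P.cost Kopt)
  have hd : ∀ s, 0 ≤ s → HasDerivWithinAt ψ (Real.exp (r * s) * r * (P.cost (α s) - P.cost Kopt)
      + Real.exp (r * s) * (-(4 * ((P.residual (α s))ᵀ * P.residual (α s)
        * symPow (P.gramian (α s)) (2 - γ)).trace))) (Ici 0) s := by
    intro s hs
    have h1 : HasDerivAt (fun s => Real.exp (r * s)) (Real.exp (r * s) * r) s := by
      simpa using ((hasDerivAt_id s).const_mul r).exp
    exact h1.hasDerivWithinAt.mul ((hα.hasDerivWithinAt_cost hP hs).sub_const _)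
  have hanti : AntitoneOn ψ (Ici 0) := by
    refine antitoneOn_of_hasDerivWithinAt_nonpos (convex_Ici 0)
      (fun s hs => (hd s hs).continuousWithinAt)
      (fun s hs => (hd s (interior_subset hs)).mono interior_subset) fun s hs => ?_
    have hs0 : 0 ≤ s := interior_subset hs
    have h1 := hcle _ (hα.mem_sublevel hP hK₀ hs0) (P.residual (α s))
    rw [Matrix.mul_one] at h1
    have h2 := hCle _ (hα.mem s hs0)
    have h3 : r * (P.cost (α s) - P.cost Kopt) ≤ 4 * (c * ‖P.residual (α s)‖ ^ 2) := by
      calc r * (P.cost (α s) - P.cost Kopt) ≤ r * (C * ‖P.residual (α s)‖ ^ 2) :=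
            mul_le_mul_of_nonneg_left h2 (by positivity)
        _ = 4 * (c * ‖P.residual (α s)‖ ^ 2) := by
            rw [hr]; field_simp
    rw [mul_assoc, ← mul_add]
    exact mul_nonpos_of_nonneg_of_nonpos (Real.exp_pos _).le (by linarith)
  have h4 := hanti (mem_Ici.2 le_rfl) (mem_Ici.2 ht) ht
  simp only [ψ, hα.init, mul_zero, Real.exp_zero, one_mul] at h4
  rw [neg_mul, Real.exp_neg, inv_mul_eq_div, le_div_iff₀ (Real.exp_pos _), mul_comm]
  exact h4

/-- On the sublevel set the cost gap lies between `c₁` and `c₂` times the squared distance to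
`Kopt`, so its decay passes to the gain at the price of the factor `c₂ / c₁`. -/
theorem Standard.exists_exponential_stability (hP : P.Standard) (γ : ℝ)
    {Kopt : Matrix (Fin m) (Fin n) ℝ} (hopt : P.IsOptimal Kopt) (a : ℝ) :
    ∃ r > 0, ∃ c > 0, ∀ K₀ ∈ P.stabilizing, P.cost K₀ ≤ a →
      ∀ α : ℝ → Matrix (Fin m) (Fin n) ℝ, P.IsNaturalGradientFlow γ K₀ α → ∀ t : ℝ, 0 ≤ t →
        P.cost (α t) - P.cost Kopt ≤ Real.exp (-r * t) * (P.cost K₀ - P.cost Kopt) ∧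
        ‖α t - Kopt‖ ^ 2 ≤ c * Real.exp (-r * t) * ‖K₀ - Kopt‖ ^ 2 := by
  obtain ⟨r, hr, hdecay⟩ := hP.exists_exponential_decay γ hopt a
  have hY : ContinuousOn P.gramian (P.sublevel a) := fun K hK =>
    (contDiffAt_gramian (k := 0) hK.1).continuousAt.continuousWithinAt
  obtain ⟨c₁, hc₁, h₁⟩ := exists_mul_norm_sq_le_trace_conj (hP.isCompact_sublevel a) hY
    (fun K hK => hP.gramian_posDef hK.1) hP.posDef_R
  obtain ⟨c₂, hc₂, h₂⟩ := exists_trace_conj_le_mul_norm_sq (hP.isCompact_sublevel a) hY P.R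
  refine ⟨r, hr, c₁⁻¹ * c₂, by positivity, fun K₀ hK₀ hle α hα t ht => ?_⟩
  have h3 := hdecay K₀ hle α hα t ht
  refine ⟨h3, ?_⟩
  have h4 := h₁ _ (hα.mem_sublevel hP hle ht) (α t - Kopt)
  rw [← hP.cost_sub_cost_of_isOptimal hopt (hα.mem t ht)] at h4
  have h5 := h₂ K₀ ⟨hK₀, hle⟩ (K₀ - Kopt)
  rw [← hP.cost_sub_cost_of_isOptimal hopt hK₀] at h5
  have h6 := mul_le_mul_of_nonneg_left h5 (Real.exp_pos (-r * t)).le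
  rw [← mul_le_mul_iff_right₀ hc₁]
  calc c₁ * ‖α t - Kopt‖ ^ 2 ≤ Real.exp (-r * t) * (c₂ * ‖K₀ - Kopt‖ ^ 2) :=
        h4.trans (h3.trans h6)
    _ = c₁ * (c₁⁻¹ * c₂ * Real.exp (-r * t) * ‖K₀ - Kopt‖ ^ 2) := by
        field_simp

end LQR

end

theorem mainTheorem7 {n m : ℕ} (P : LQR n m) (hP : P.Standard) (γ : ℝ) (hγ : 0 < γ) :
    -- `X_K` and `Y_K` are the unique solutions of their Lyapunov equations
    (∀ K ∈ P.stabilizing,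
      (∀ X : Matrix (Fin n) (Fin n) ℝ,
        (P.closedLoop K)ᵀ * X + X * P.closedLoop K + Kᵀ * P.R * K + P.Q = 0
          ↔ X = P.valueMatrix K) ∧
      (∀ Y : Matrix (Fin n) (Fin n) ℝ,
        P.closedLoop K * Y + Y * (P.closedLoop K)ᵀ + P.initCov = 0 ↔ Y = P.gramian K)) ∧
    -- the metric and the gradient
    IsRiemannianMetricOn P.stabilizing (P.metric γ) ∧
    (∀ K ∈ P.stabilizing, ∀ G : Matrix (Fin m) (Fin n) ℝ,
      IsRiemannianGradientAt (P.metric γ) P.cost K G ↔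
        G = (2 : ℝ) • ((P.R * K - P.Bᵀ * P.valueMatrix K) * symPow (P.gramian K) (1 - γ))) ∧
    -- the flow has exactly one solution from every initial gain
    (∀ K₀ ∈ P.stabilizing, ∃ K : ℝ → Matrix (Fin m) (Fin n) ℝ,
      P.IsNaturalGradientFlow γ K₀ K ∧
      ∀ L : ℝ → Matrix (Fin m) (Fin n) ℝ,
        P.IsNaturalGradientFlow γ K₀ L → Set.EqOn L K (Set.Ici 0)) ∧
    -- exponential convergence to the unique optimal gain, uniformly on sublevel sets;
    -- the norm is the Frobenius norm
    ∃ Kopt : Matrix (Fin m) (Fin n) ℝ,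
      P.IsOptimal Kopt ∧ (∀ K, P.IsOptimal K → K = Kopt) ∧
      ∀ a : ℝ, ∃ r > 0, ∃ c > 0, ∀ K₀ ∈ P.stabilizing, P.cost K₀ ≤ a →
        ∀ K : ℝ → Matrix (Fin m) (Fin n) ℝ, P.IsNaturalGradientFlow γ K₀ K →
          ∀ t : ℝ, 0 ≤ t →
            P.cost (K t) - P.cost Kopt ≤ Real.exp (-r * t) * (P.cost K₀ - P.cost Kopt) ∧
            ‖K t - Kopt‖ ^ 2 ≤ c * Real.exp (-r * t) * ‖K₀ - Kopt‖ ^ 2 := by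
  refine ⟨fun K hK => ⟨LQR.valueMatrix_iff hK, LQR.gramian_iff hK⟩, hP.isRiemannianMetricOn γ,
    fun K hK G => hP.isRiemannianGradientAt_iff γ hK G, fun K₀ hK₀ => hP.exists_unique_flow γ hK₀, ?_⟩
  obtain ⟨Kopt, hopt⟩ := hP.exists_isOptimal
  exact ⟨Kopt, hopt, fun K hK => hP.isOptimal_unique hopt hK,
    fun a => hP.exists_exponential_stability γ hopt a⟩
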